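/- Let $q=p^e$ be a power of a prime $p$, let $\ell\ge 1$, and let $X$ be a smooth projective geometrically irreducible curve over $\mathbf F_{q^\ell}$ with function field $F$. For a divisor $A$ on $X$, let $\Omega(A)$ be the $\mathbf F_{q^\ell}$-space of rational differential forms $\omega\in\Omega_{F/\mathbf F_{q^\ell}}$ such that $v_P(\omega)\ge v_P(A)$ at every place $P$, and put $h^1(A)=\dim_{\mathbf F_{q^\ell}}\Omega(A)$. Let $\mathcal C$ be the Cartier operator on $\Omega_{F/\mathbf F_{q^\ell}}$: for a separating element $x$ of $F$ and $\omega=(f_0^p+f_1^px+\cdots+f_{p-1}^px^{p-1})\,dx$, one has $\mathcal C(\omega)=f_{p-1}\,dx$, which does not depend on $x$. Put $\mathcal C_q=\mathcal C^{e}$. Let $P_1,\dots,P_n$ be distinct $\mathbf F_{q^\ell}$-rational points of $X$ and $D=P_1+\cdots+P_n$. For a divisor $G$ on $X$ whose support is disjoint from that of $D$, let $$Car_q(D,G)=\{(\mathrm{res}_{P_1}(\omega),\dots,\mathrm{res}_{P_n}(\omega))\ :\ \omega\in\Omega(G-D),\ \mathcal C_q(\omega)=\omega\}\subseteq\mathbf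 F_q^n.$$ Let $G=G^+-G^-$, where $G^+,G^-\ge 0$, the divisor $G^-$ is reduced (all its multiplicities are equal to $1$), and $G^+$, $G^-$ and $D$ have pairwise disjoint supports. Let $s_{G^-}$ be the number of places in the support of $G^-$. Then $$\dim_{\mathbf F_q}Car_q(D,G)\ \ge\ n-1+s_{G^-}-\ell\deg(G^+)-h^1(G).$$ -/

import Mathlib

open scoped KaehlerDifferential

namespace CartierCode

/-- `F/K` is the function field of a smooth projective geometrically irreducible curve over the
(perfect) field `K`: a finite extension of `K(x)` for some transcendental `x`, in which `K` is
algebraically closed. -/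
structure IsFunctionField (K F : Type*) [Field K] [Field F] [Algebra K F] : Prop where
  exists_transcendental : ∃ x : F, Transcendental K x ∧
    FiniteDimensional (IntermediateField.adjoin K {x}) F
  full_constant_field : ∀ y : F, IsAlgebraic K y → y ∈ (algebraMap K F).range

/-- A place of `F/K`: a discrete valuation ring of `F` containing `K`. -/
structure Place (K F : Type*) [Field K] [Field F] [Algebra K F] where
  /-- the local ring at the place -/
  ring : ValuationSubring F
  algebraMap_mem : ∀ a : K, algebraMap K F a ∈ ring
  isDVR : IsDiscreteValuationRing ring

section

variable {K F : Type*} [Field K] [Field F] [Algebra K F]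

instance (P : Place K F) : IsDiscreteValuationRing P.ring := P.isDVR

instance (P : Place K F) : Algebra K P.ring :=
  ((algebraMap K F).codRestrict P.ring P.algebraMap_mem).toAlgebra

/-- The normalised discrete valuation at `P`, written multiplicatively:
`v_P(f) ≥ m` reads `P.val f ≤ WithZero.exp (-m)`. -/
noncomputable def Place.val (P : Place K F) : Valuation F (WithZero (Multiplicative ℤ)) :=
  (IsDiscreteValuationRing.maximalIdeal P.ring).valuation F

/-- `t` is a uniformising parameter at `P`: `v_P(t) = 1`. -/
def Place.IsUniformizer (P : Place K F) (t : F) : Prop :=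
  P.val t = WithZero.exp (-1 : ℤ)

/-- The degree of a place: the degree over `K` of its residue field. -/
noncomputable def Place.degree (P : Place K F) : ℕ :=
  Module.finrank K (IsLocalRing.ResidueField P.ring)

variable (K F) in
/-- Divisors: finitely supported integer combinations of places. -/
abbrev Divisor : Type _ := Place K F →₀ ℤ

/-- The degree of a divisor. -/
noncomputable def Divisor.deg (A : Divisor K F) : ℤ :=
  A.sum fun P m => m * (P.degree : ℤ)

/-- A divisor which is a sum of pairwise distinct places, each with multiplicity one. -/
def Divisor.IsReduced (A : Divisor K F) : Prop :=
  ∀ P ∈ A.support, A P = 1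

/-- The divisor `P₁ + ⋯ + Pₙ`. -/
noncomputable def Divisor.ofPoints {n : ℕ} (P : Fin n → Place K F) : Divisor K F :=
  ∑ i, Finsupp.single (P i) 1

/-- `v_P(ω) ≥ m`: writing `ω = f dt` with `t` a uniformising parameter at `P`, `v_P(f) ≥ m`. -/
def Place.OrdGE (P : Place K F) (ω : Ω[F⁄K]) (m : ℤ) : Prop :=
  ∀ t : F, P.IsUniformizer t →
    ∃ f : F, ω = f • KaehlerDifferential.D K F t ∧ P.val f ≤ WithZero.exp (-m)

/-- The `K`-space `Ω(A)` of rational differential forms `ω` such that `v_P(ω) ≥ v_P(A)` at every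
place `P`. -/
def Omega (A : Divisor K F) : Submodule K Ω[F⁄K] where
  carrier := {ω | ∀ P : Place K F, P.OrdGE ω (A P)}
  zero_mem' := fun P t _ => ⟨0, by simp, by simp⟩
  add_mem' := by
    intro ω η hω hη P t ht
    obtain ⟨f, rfl, hf⟩ := hω P t ht
    obtain ⟨g, rfl, hg⟩ := hη P t ht
    exact ⟨f + g, (add_smul _ _ _).symm, (P.val.map_add f g).trans (max_le hf hg)⟩
  smul_mem' := by
    intro c ω hω P t ht
    obtain ⟨f, rfl, hf⟩ := hω P t ht
    refine ⟨algebraMap K F c * f, by rw [mul_smul, algebraMap_smul], ?_⟩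
    have hc : P.val (algebraMap K F c) ≤ 1 :=
      IsDedekindDomain.HeightOneSpectrum.valuation_le_one
        (IsDiscreteValuationRing.maximalIdeal P.ring) ⟨_, P.algebraMap_mem c⟩
    rw [map_mul]
    calc P.val (algebraMap K F c) * P.val f ≤ 1 * P.val f := by gcongr
      _ ≤ _ := by rwa [one_mul]

/-- `h¹(A)`, the dimension of `Ω(A)` over the constant field `K`. -/
noncomputable def h1 (A : Divisor K F) : ℕ := Module.finrank K (Omega A)

/-- `c` is the residue of `ω` at the rational place `P`: if `t` is a uniformising parameter and
`ω = f dt`, then `f = ⋯ + a₂ t⁻³ + a₁ t⁻² + a₀ t⁻¹ + (a function regular at P)`, with finitely many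
polar terms, constants `aᵢ` in `K`, and `a₀ = c`. -/
def Place.HasResidue (P : Place K F) (ω : Ω[F⁄K]) (c : K) : Prop :=
  ∀ t : F, P.IsUniformizer t →
    ∃ f : F, ω = f • KaehlerDifferential.D K F t ∧
      ∃ (N : ℕ) (a : ℕ → K), a 0 = c ∧
        f - ∑ i ∈ Finset.range (N + 1), algebraMap K F (a i) * t⁻¹ ^ (i + 1) ∈ P.ring

/-- `η = 𝒞(ω)` for the Cartier operator `𝒞` in characteristic `p`: for every separating
element `x` (that is, `dx ≠ 0`), one has
`ω = (f₀ᵖ + f₁ᵖ x + ⋯ + f_{p-1}ᵖ x^{p-1}) dx` and `η = f_{p-1} dx`. -/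
def IsCartier (p : ℕ) (ω η : Ω[F⁄K]) : Prop :=
  ∀ x : F, KaehlerDifferential.D K F x ≠ 0 →
    ∃ f : ℕ → F,
      ω = (∑ i ∈ Finset.range p, f i ^ p * x ^ i) • KaehlerDifferential.D K F x ∧
      η = f (p - 1) • KaehlerDifferential.D K F x

/-- `η = 𝒞ᵉ(ω)` for the `e`-fold iterate of the Cartier operator. -/
def IsCartierIter (p : ℕ) : ℕ → Ω[F⁄K] → Ω[F⁄K] → Prop
  | 0, ω, η => ω = η
  | e + 1, ω, η => ∃ ξ : Ω[F⁄K], IsCartier p ω ξ ∧ IsCartierIter p e ξ η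

theorem HasResidue.add {P : Place K F} {ω η : Ω[F⁄K]} {c d : K}
    (hω : P.HasResidue ω c) (hη : P.HasResidue η d) : P.HasResidue (ω + η) (c + d) := by
  have pad : ∀ {f t : F} {N : ℕ} {a : ℕ → K} (M : ℕ), N ≤ M →
      f - ∑ i ∈ Finset.range (N + 1), algebraMap K F (a i) * t⁻¹ ^ (i + 1) ∈ P.ring →
      f - ∑ i ∈ Finset.range (M + 1),
        algebraMap K F (if i < N + 1 then a i else 0) * t⁻¹ ^ (i + 1) ∈ P.ring := by
    intro f t N a M hNM h
    convert h using 2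
    rw [← Finset.sum_subset (Finset.range_mono (Nat.succ_le_succ hNM))]
    · refine Finset.sum_congr rfl fun i hi => ?_
      rw [if_pos (Finset.mem_range.1 hi)]
    · intro i _ hi
      rw [if_neg (by simpa using hi)]
      simp
  intro t ht
  obtain ⟨f, rfl, N, a, ha, hf⟩ := hω t ht
  obtain ⟨g, rfl, M, b, hb, hg⟩ := hη t ht
  refine ⟨f + g, (add_smul _ _ _).symm, max N M,
    fun i => (if i < N + 1 then a i else 0) + (if i < M + 1 then b i else 0), by simp [ha, hb], ?_⟩
  have := add_mem (pad (max N M) (le_max_left _ _) hf) (pad (max N M) (le_max_right _ _) hg)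
  convert this using 1
  simp only [map_add, add_mul, Finset.sum_add_distrib]
  ring

theorem HasResidue.smul {P : Place K F} {ω : Ω[F⁄K]} {c : K} (k : K)
    (hω : P.HasResidue ω c) : P.HasResidue (k • ω) (k * c) := by
  intro t ht
  obtain ⟨f, rfl, N, a, ha, hf⟩ := hω t ht
  refine ⟨algebraMap K F k * f, by rw [mul_smul, algebraMap_smul], N, fun i => k * a i,
    by simp [ha], ?_⟩
  convert mul_mem (P.algebraMap_mem k) hf using 1
  simp only [map_mul, mul_sub, Finset.mul_sum, mul_assoc]

theorem HasResidue.zero (P : Place K F) : P.HasResidue (0 : Ω[F⁄K]) 0 :=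
  fun t _ => ⟨0, by simp, 0, 0, rfl, by simp⟩

theorem IsCartier.add {p : ℕ} [Fact p.Prime] [CharP F p] {ω η ω' η' : Ω[F⁄K]}
    (h : IsCartier p ω η) (h' : IsCartier p ω' η') : IsCartier p (ω + ω') (η + η') := by
  intro x hx
  obtain ⟨f, rfl, rfl⟩ := h x hx
  obtain ⟨g, rfl, rfl⟩ := h' x hx
  refine ⟨fun i => f i + g i, ?_, (add_smul _ _ _).symm⟩
  rw [← add_smul, ← Finset.sum_add_distrib]
  congr 1
  refine Finset.sum_congr rfl fun i _ => ?_
  rw [add_pow_char, add_mul]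

theorem IsCartier.smul {p : ℕ} {ω η : Ω[F⁄K]} (c : K)
    (h : IsCartier p ω η) : IsCartier p (c ^ p • ω) (c • η) := by
  intro x hx
  obtain ⟨f, rfl, rfl⟩ := h x hx
  refine ⟨fun i => algebraMap K F c * f i, ?_, by rw [mul_smul, algebraMap_smul]⟩
  simp only [mul_pow, mul_assoc, ← Finset.mul_sum]
  rw [mul_smul, ← map_pow, algebraMap_smul]

theorem IsCartier.zero {p : ℕ} [Fact p.Prime] : IsCartier p (0 : Ω[F⁄K]) 0 :=
  fun x _ => ⟨0, by simp [(Fact.out : p.Prime).ne_zero], by simp⟩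

theorem IsCartierIter.add {p : ℕ} [Fact p.Prime] [CharP F p] {e : ℕ} {ω η ω' η' : Ω[F⁄K]}
    (h : IsCartierIter p e ω η) (h' : IsCartierIter p e ω' η') :
    IsCartierIter p e (ω + ω') (η + η') := by
  induction e generalizing ω ω' with
  | zero => exact congrArg₂ (· + ·) h h'
  | succ e ih =>
    obtain ⟨ξ, h1, h2⟩ := h
    obtain ⟨ξ', h1', h2'⟩ := h'
    exact ⟨ξ + ξ', h1.add h1', ih h2 h2'⟩

theorem IsCartierIter.smul {p e : ℕ} {ω η : Ω[F⁄K]} (c : K)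
    (h : IsCartierIter p e ω η) : IsCartierIter p e (c ^ p ^ e • ω) (c • η) := by
  induction e generalizing ω with
  | zero => simpa [IsCartierIter] using congrArg (c • ·) h
  | succ e ih =>
    obtain ⟨ξ, h1, h2⟩ := h
    exact ⟨c ^ p ^ e • ξ, by simpa [pow_succ, pow_mul] using h1.smul (c ^ p ^ e), ih h2⟩

theorem IsCartierIter.zero {p : ℕ} [Fact p.Prime] (e : ℕ) :
    IsCartierIter p e (0 : Ω[F⁄K]) 0 := by
  induction e with
  | zero => rfl
  | succ e ih => exact ⟨0, IsCartier.zero, ih⟩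

/-- The code `Car_q(D, G)` over the field `k` with `q = pᵉ` elements, where `D = P₁ + ⋯ + Pₙ`: the
set of all `(res_{P₁}(ω), …, res_{Pₙ}(ω)) ∈ kⁿ` with `ω ∈ Ω(G - D)` and `𝒞_q(ω) = ω`, where
`𝒞_q = 𝒞ᵉ`. -/
def Car (p : ℕ) [Fact p.Prime] [CharP F p] {k : Type*} [Field k] [Algebra k K] {e : ℕ}
    (hk : Nat.card k = p ^ e) {n : ℕ} (P : Fin n → Place K F) (G : Divisor K F) :
    Submodule k (Fin n → k) where
  carrier := {c | ∃ ω ∈ Omega (G - Divisor.ofPoints P), IsCartierIter p e ω ω ∧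
    ∀ i, (P i).HasResidue ω (algebraMap k K (c i))}
  zero_mem' := ⟨0, zero_mem _, IsCartierIter.zero e, fun i => by
    simpa using HasResidue.zero (P i)⟩
  add_mem' := by
    rintro c d ⟨ω, hω, hC, hr⟩ ⟨η, hη, hC', hr'⟩
    exact ⟨ω + η, add_mem hω hη, hC.add hC', fun i => by
      simpa using HasResidue.add (hr i) (hr' i)⟩
  smul_mem' := by
    rintro a c ⟨ω, hω, hC, hr⟩
    refine ⟨algebraMap k K a • ω, Submodule.smul_mem _ _ hω, ?_, fun i => by
      simpa using HasResidue.smul (algebraMap k K a) (hr i)⟩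
    have hfin : Finite k := Nat.finite_of_card_ne_zero (by
      rw [hk]; exact pow_ne_zero _ (Fact.out : p.Prime).ne_zero)
    have := Fintype.ofFinite k
    have h := hC.smul (algebraMap k K a)
    rwa [← map_pow, ← hk, Nat.card_eq_fintype_card, FiniteField.pow_card] at h

end

end CartierCode

/-!
A logarithmic differential `df / f` is fixed by the Cartier operator, has at most simple poles, and
has residue `ord_P f` at `P`. Since class groups over a finite field are finite, the functions
without zeros and poles outside a finite set `E` of places form a group of rank `|E| - 1`; when `E`
is the support of `G⁻ + D`, they give `n + s - 1` logarithmic differentials in `Ω(-G⁻ - D)`. They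
can be chosen linearly independent over the field of constants: since they are fixed by the Cartier
operator, Artin's argument reduces a relation to one over the prime field, that is, to a product of
powers of the functions which is a `p`-th power.

Among the combinations with coefficients in `𝔽_q`, those that vanish to order `G⁺` lie in `Ω(G - D)`
and lose at most `ℓ deg G⁺` dimensions. A combination in `Ω(G - D)` all of whose residues are zero
is regular at the points of `D`, hence lies in `Ω(G)`. Independence over the field of constants
bounds the space of such combinations by `h¹(G)`, without a factor `ℓ`.
-/

namespace CartierCode

open KaehlerDifferential IntermediateField

section Differentials

variable {K F : Type*} [Field K] [Field F] [Algebra K F]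

theorem IsFunctionField.essFiniteType (hF : IsFunctionField K F) : Algebra.EssFiniteType K F := by
  obtain ⟨x, -, hfin⟩ := hF.exists_transcendental
  have : Algebra.EssFiniteType K K⟮x⟯ := essFiniteType_iff.2 ⟨{x}, by simp⟩
  exact Algebra.EssFiniteType.comp K K⟮x⟯ F

theorem IsFunctionField.exists_isSeparable_adjoin [PerfectField K] (hF : IsFunctionField K F) :
    ∃ x : F, Algebra.IsSeparable K⟮x⟯ F := by
  have := hF.essFiniteType
  obtain ⟨s, hs, hsep⟩ := exists_isTranscendenceBasis_and_isSeparable_of_perfectField K F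
  obtain ⟨x, hx, hfin⟩ := hF.exists_transcendental
  have hbasis : IsTranscendenceBasis K (fun _ : Unit => x) := by
    refine (algebraicIndependent_unique_type_iff.2 hx).isTranscendenceBasis_iff_isAlgebraic.2 ?_
    rw [Set.range_const, ← isAlgebraic_adjoin_iff_top]
    infer_instance
  have hcard : s.card = 1 := by simpa using hs.lift_cardinalMk_eq hbasis
  obtain ⟨y, rfl⟩ := Finset.card_eq_one.1 hcard
  rw [Finset.coe_singleton] at hsep
  exact ⟨y, hsep⟩

theorem IsFunctionField.nontrivial_kaehler (hF : IsFunctionField K F) : Nontrivial Ω[F⁄K] := by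
  by_contra h
  have := hF.essFiniteType
  have : Algebra.FormallyUnramified K F := ⟨not_nontrivial_iff_subsingleton.1 h⟩
  have := Algebra.FormallyUnramified.finite_of_free (R := K) (S := F)
  obtain ⟨x, hx, -⟩ := hF.exists_transcendental
  exact hx (Algebra.IsAlgebraic.isAlgebraic x)

theorem D_mem_span_of_mem_adjoin {x z : F} (hz : z ∈ K⟮x⟯) :
    D K F z ∈ Submodule.span F {D K F x} := by
  induction hz using adjoin_induction with
  | mem y hy =>
    obtain rfl := hy
    exact Submodule.mem_span_singleton_self _
  | algebraMap c => rw [(D K F).map_algebraMap]; exact zero_mem _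
  | add y z _ _ hy hz => rw [map_add]; exact add_mem hy hz
  | inv y _ hy => rw [Derivation.leibniz_inv]; exact Submodule.smul_mem _ _ hy
  | mul y z _ _ hy hz =>
    rw [Derivation.leibniz]
    exact add_mem (Submodule.smul_mem _ _ hz) (Submodule.smul_mem _ _ hy)

theorem span_D_eq_top_of_formallyUnramified (x : F) [Algebra.FormallyUnramified K⟮x⟯ F] :
    Submodule.span F {D K F x} = ⊤ := by
  refine eq_top_iff.2 fun ω _ => ?_
  obtain ⟨τ, rfl⟩ := (exact_mapBaseChange_map K K⟮x⟯ F ω).1 (Subsingleton.elim _ _)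
  induction τ with
  | zero => rw [map_zero]; exact zero_mem _
  | add σ τ hσ hτ => rw [map_add]; exact add_mem (hσ trivial) (hτ trivial)
  | tmul f η =>
    rw [mapBaseChange_tmul]
    refine Submodule.smul_mem _ f ?_
    clear * -
    have hη : η ∈ Submodule.span K⟮x⟯ (Set.range (D K K⟮x⟯)) := by
      rw [span_range_derivation]; trivial
    induction hη using Submodule.span_induction with
    | mem η hη =>
      obtain ⟨z, rfl⟩ := hη
      rw [map_D]
      exact D_mem_span_of_mem_adjoin z.2
    | zero => rw [map_zero]; exact zero_mem _
    | add η ξ _ _ hη hξ => rw [map_add]; exact add_mem hη hξ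
    | smul z η _ hη => rw [map_smul]; exact Submodule.smul_of_tower_mem _ z hη

theorem IsFunctionField.exists_smul_D [PerfectField K] (hF : IsFunctionField K F)
    {x : F} (hx : D K F x ≠ 0) (ω : Ω[F⁄K]) : ∃ c : F, ω = c • D K F x := by
  obtain ⟨y, hsep⟩ := hF.exists_isSeparable_adjoin
  have := Algebra.FormallyUnramified.of_isSeparable K⟮y⟯ F
  have hspan (η : Ω[F⁄K]) : ∃ c : F, c • D K F y = η :=
    Submodule.mem_span_singleton.1 (by
      rw [span_D_eq_top_of_formallyUnramified]; trivial)
  obtain ⟨a, ha⟩ := hspan (D K F x)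
  obtain ⟨b, rfl⟩ := hspan ω
  have ha0 : a ≠ 0 := by rintro rfl; exact hx (by rw [← ha, zero_smul])
  exact ⟨b * a⁻¹, by rw [← ha, smul_smul, inv_mul_cancel_right₀ ha0]⟩

theorem IsFunctionField.formallyUnramified_adjoin [PerfectField K] (hF : IsFunctionField K F)
    {x : F} (hx : D K F x ≠ 0) : Algebra.FormallyUnramified K⟮x⟯ F := by
  constructor
  refine subsingleton_of_forall_eq 0 fun η => ?_
  obtain ⟨ω, rfl⟩ := map_surjective K K⟮x⟯ F η
  obtain ⟨c, rfl⟩ := hF.exists_smul_D hx ω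
  have hDx : D K⟮x⟯ F (algebraMap F F x) = 0 :=
    (D K⟮x⟯ F).map_algebraMap ⟨x, mem_adjoin_simple_self K x⟩
  rw [map_smul, map_D, hDx, smul_zero]

theorem IsFunctionField.finite_adjoin [PerfectField K] (hF : IsFunctionField K F)
    {x : F} (hx : D K F x ≠ 0) : Module.Finite K⟮x⟯ F := by
  have := hF.essFiniteType
  have := hF.formallyUnramified_adjoin hx
  have := Algebra.EssFiniteType.of_comp K K⟮x⟯ F
  exact Algebra.FormallyUnramified.finite_of_free (R := K⟮x⟯) (S := F)

theorem IsFunctionField.isSeparable_adjoin [PerfectField K] (hF : IsFunctionField K F)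
    {x : F} (hx : D K F x ≠ 0) : Algebra.IsSeparable K⟮x⟯ F := by
  have := hF.essFiniteType
  have := hF.formallyUnramified_adjoin hx
  have := Algebra.EssFiniteType.of_comp K K⟮x⟯ F
  exact Algebra.FormallyUnramified.isSeparable _ _

theorem IsFunctionField.exists_D_ne_zero (hF : IsFunctionField K F) : ∃ x : F, D K F x ≠ 0 := by
  by_contra! h
  have := hF.nontrivial_kaehler
  refine top_ne_bot (α := Submodule F Ω[F⁄K]) ?_
  rw [← span_range_derivation, Submodule.span_eq_bot]
  exact Set.forall_mem_range.2 h

theorem IsFunctionField.transcendental_of_D_ne_zero (hF : IsFunctionField K F)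
    {x : F} (hx : D K F x ≠ 0) : Transcendental K x := by
  intro h
  obtain ⟨c, rfl⟩ := hF.full_constant_field x h
  exact hx ((D K F).map_algebraMap c)

end Differentials

section PowerExpansions

variable {K F : Type*} [Field K] [Field F] [Algebra K F] (p : ℕ)

variable (x : F) in
/-- `x` generates `F` as an algebra over its subfield `Fᵖ` of `p`-th powers: every element has an
expansion `g₀ᵖ + g₁ᵖ x + ⋯ + g_{p-1}ᵖ x^{p-1}`, the form in which the Cartier operator is
computed. -/
def IsPGenerator : Prop :=
  ∀ y : F, ∃ g : ℕ → F, y = ∑ i ∈ Finset.range p, g i ^ p * x ^ i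

variable [CharP F p]

theorem D_pow_char (g : F) : D K F (g ^ p) = 0 := by
  rw [Derivation.leibniz_pow, ← Nat.cast_smul_eq_nsmul F, CharP.cast_eq_zero, zero_smul]

theorem natCast_ne_zero_of_lt {i : ℕ} (hi0 : i ≠ 0) (hi : i < p) : (i : F) ≠ 0 := by
  rw [Ne, CharP.cast_eq_zero_iff F p]
  exact fun hdvd => hi0 (Nat.eq_zero_of_dvd_of_lt hdvd hi)

variable [Fact p.Prime]

theorem D_sum_pow_mul_pow (g : ℕ → F) (x : F) (n : ℕ) :
    D K F (∑ i ∈ Finset.range (n + 1), g i ^ p * x ^ i) =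
      (∑ i ∈ Finset.range n, (((i + 1 : ℕ) : F) * g (i + 1)) ^ p * x ^ i) • D K F x := by
  rw [Finset.sum_range_succ', map_add, pow_zero, mul_one, D_pow_char, add_zero, map_sum,
    Finset.sum_smul]
  refine Finset.sum_congr rfl fun i _ => ?_
  rw [Derivation.leibniz, D_pow_char p, smul_zero, add_zero, Derivation.leibniz_pow,
    ← Nat.cast_smul_eq_nsmul F, smul_smul, smul_smul, Nat.add_sub_cancel, mul_pow,
    ← frobenius_def (R := F) p (i + 1 : ℕ), map_natCast]
  congr 1
  ring

/-- Differentiating with respect to `x` lowers the number of terms. -/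
theorem eq_zero_of_sum_pow_mul_pow_eq_zero {x : F} (hx : D K F x ≠ 0) {n : ℕ} (hn : n ≤ p)
    {g : ℕ → F} (hg : ∑ i ∈ Finset.range n, g i ^ p * x ^ i = 0) : ∀ i < n, g i = 0 := by
  have hp : p ≠ 0 := (Fact.out : p.Prime).ne_zero
  induction n generalizing g with
  | zero => simp
  | succ n ih =>
    have hderiv : ∑ i ∈ Finset.range n, (((i + 1 : ℕ) : F) * g (i + 1)) ^ p * x ^ i = 0 := by
      have h := D_sum_pow_mul_pow (K := K) p g x n
      rw [hg, map_zero] at h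
      exact (smul_eq_zero.1 h.symm).resolve_right hx
    have hsucc (i : ℕ) (hi : i < n) : g (i + 1) = 0 :=
      (mul_eq_zero.1 (ih (by omega) hderiv i hi)).resolve_left
        (natCast_ne_zero_of_lt p i.succ_ne_zero (by omega))
    rw [Finset.sum_range_succ', Finset.sum_eq_zero fun i hi => by
      rw [hsucc i (Finset.mem_range.1 hi), zero_pow hp, zero_mul]] at hg
    rintro (_ | i) hi
    · simpa [hp] using hg
    · exact hsucc i (by omega)

theorem IsPGenerator.eq_pow_of_D_eq_zero {x : F} (hgen : IsPGenerator p x) (hx : D K F x ≠ 0)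
    {f : F} (hf : D K F f = 0) : ∃ g : F, f = g ^ p := by
  obtain ⟨g, rfl⟩ := hgen f
  obtain ⟨m, hm⟩ : ∃ m, p = m + 1 := ⟨p - 1, (Nat.succ_pred_prime Fact.out).symm⟩
  have hderiv : ∑ i ∈ Finset.range m, (((i + 1 : ℕ) : F) * g (i + 1)) ^ p * x ^ i = 0 := by
    rw [congrArg Finset.range hm, D_sum_pow_mul_pow] at hf
    exact (smul_eq_zero.1 hf).resolve_right hx
  refine ⟨g 0, ?_⟩
  rw [congrArg Finset.range hm, Finset.sum_range_succ', pow_zero, mul_one,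
    Finset.sum_eq_zero, zero_add]
  intro i hi
  have hi : i < m := Finset.mem_range.1 hi
  rw [(mul_eq_zero.1 (eq_zero_of_sum_pow_mul_pow_eq_zero p hx (by omega) hderiv i hi)).resolve_left
    (natCast_ne_zero_of_lt p i.succ_ne_zero (by omega)), zero_pow (by omega), zero_mul]

/-- Over `Fᵖ(x)` the field `F` is both separable and purely inseparable. -/
theorem adjoin_frobenius_fieldRange_eq_top [PerfectField K] (x : F)
    [Algebra.IsSeparable K⟮x⟯ F] : adjoin (frobenius F p).fieldRange {x} = ⊤ := by
  have : CharP K p := (algebraMap K F).charP (algebraMap K F).injective p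
  set E := adjoin (frobenius F p).fieldRange {x}
  have hfrob (y : F) : y ^ p ∈ E := E.algebraMap_mem ⟨y ^ p, y, rfl⟩
  have hle : K⟮x⟯.toSubfield ≤ E.toSubfield := by
    refine Subfield.closure_le.2 ?_
    rintro _ (⟨c, rfl⟩ | rfl)
    · obtain ⟨d, rfl⟩ := (PerfectRing.bijective_frobenius (R := K) (p := p)).2 c
      change algebraMap K F (d ^ p) ∈ E
      rw [map_pow]
      exact hfrob _
    · exact mem_adjoin_simple_self _ _
  let : Algebra K⟮x⟯ E := (Subfield.inclusion hle).toAlgebra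
  have : IsScalarTower K⟮x⟯ E F := .of_algebraMap_eq fun _ => rfl
  have : Algebra.IsSeparable E F := Algebra.isSeparable_tower_top_of_isSeparable K⟮x⟯ E F
  have : ExpChar E p := (algebraMap E F).expChar (algebraMap E F).injective p
  have : IsPurelyInseparable E F :=
    (isPurelyInseparable_iff_pow_mem E p).2 fun y => ⟨1, ⟨y ^ p, hfrob y⟩, by rw [pow_one]; rfl⟩
  refine eq_top_iff.2 fun y _ => ?_
  obtain ⟨z, rfl⟩ := IsPurelyInseparable.surjective_algebraMap_of_isSeparable E F y
  exact z.2

theorem isPGenerator_of_isSeparable [PerfectField K] (x : F) [Algebra.IsSeparable K⟮x⟯ F] :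
    IsPGenerator p x := by
  intro y
  let a : (frobenius F p).fieldRange := ⟨x ^ p, x, rfl⟩
  have hmonic : (Polynomial.X ^ p - Polynomial.C a).Monic :=
    Polynomial.monic_X_pow_sub_C a (Fact.out : p.Prime).ne_zero
  have hroot : Polynomial.aeval x (Polynomial.X ^ p - Polynomial.C a) = 0 := by
    rw [map_sub, map_pow, Polynomial.aeval_X, Polynomial.aeval_C]
    exact sub_self _
  have hy : y ∈ Submodule.span (frobenius F p).fieldRange ((x ^ ·) '' Finset.range p) := by
    classical
    have h := Submodule.span_range_natDegree_eq_adjoin hmonic hroot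
    rw [Polynomial.natDegree_X_pow_sub_C, ← adjoin_simple_toSubalgebra_of_isAlgebraic
      (IsIntegral.isAlgebraic ⟨_, hmonic, hroot⟩), adjoin_frobenius_fieldRange_eq_top (K := K),
      Finset.coe_image] at h
    rw [h]
    trivial
  obtain ⟨c, rfl⟩ := (Submodule.mem_span_image_finset_iff_exists_fun' _).1 hy
  choose root hroot using fun i => (c i).2
  exact ⟨root, Finset.sum_congr rfl fun i _ =>
    congrArg (· * x ^ i) (hroot i).symm⟩

theorem IsFunctionField.isPGenerator [PerfectField K] (hF : IsFunctionField K F) {x : F}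
    (hx : D K F x ≠ 0) : IsPGenerator p x :=
  have := hF.isSeparable_adjoin hx
  isPGenerator_of_isSeparable (K := K) p x

end PowerExpansions

section CartierOperator

variable {K F : Type*} [Field K] [Field F] [Algebra K F] {p : ℕ} {x : F}

theorem inv_smul_D_mul {f g : F} (hf : f ≠ 0) (hg : g ≠ 0) :
    (f * g)⁻¹ • D K F (f * g) = f⁻¹ • D K F f + g⁻¹ • D K F g := by
  rw [Derivation.leibniz, smul_add, smul_smul, smul_smul, add_comm]
  congr 2 <;> field_simp

theorem inv_inv_smul_D_inv (f : F) : f⁻¹⁻¹ • D K F f⁻¹ = -(f⁻¹ • D K F f) := by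
  rcases eq_or_ne f 0 with rfl | hf
  · simp only [inv_zero, map_zero, smul_zero, neg_zero]
  · rw [Derivation.leibniz_inv, smul_smul, ← neg_smul]
    congr 1
    field_simp

variable (p x) in
/-- `η` is the image of `ω` under the Cartier operator computed with the coordinate `x`. -/
def IsCartierAt (ω η : Ω[F⁄K]) : Prop :=
  ∃ f : ℕ → F,
    ω = (∑ i ∈ Finset.range p, f i ^ p * x ^ i) • D K F x ∧ η = f (p - 1) • D K F x

theorem IsCartierAt.smul {ω η : Ω[F⁄K]} (c : F) (h : IsCartierAt p x ω η) :
    IsCartierAt p x (c ^ p • ω) (c • η) := by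
  obtain ⟨f, rfl, rfl⟩ := h
  refine ⟨fun i => c * f i, ?_, smul_smul _ _ _⟩
  simp only [mul_pow, mul_assoc, ← Finset.mul_sum, mul_smul]

variable [Fact p.Prime]

theorem IsCartierAt.zero : IsCartierAt p x (0 : Ω[F⁄K]) 0 :=
  ⟨0, by simp [(Fact.out : p.Prime).ne_zero], by simp⟩

theorem isCartierAt_inv_smul_D_self (hx : x ≠ 0) :
    IsCartierAt p x (x⁻¹ • D K F x) (x⁻¹ • D K F x) := by
  have hp : p - 1 + 1 = p := Nat.succ_pred_prime Fact.out
  refine ⟨Pi.single (p - 1) x⁻¹, ?_, by rw [Pi.single_eq_same]⟩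
  rw [Finset.sum_eq_single_of_mem (p - 1) (Finset.mem_range.2 (by omega)), Pi.single_eq_same]
  · congr 1
    rw [inv_pow, ← congrArg (x ^ ·) hp, pow_succ]
    field_simp
  · intro i _ hi
    rw [Pi.single_eq_of_ne hi, zero_pow (by omega), zero_mul]

/-- In `ℤ[X]` one has `(X + 1)ᵖ = Xᵖ + 1 + pH`; differentiate and cancel `p`. -/
theorem exists_add_one_pow_smul_D_eq (s : F) :
    ∃ h : F, (s + 1) ^ (p - 1) • D K F (s + 1) = s ^ (p - 1) • D K F s + D K F h := by
  open Polynomial in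
  have hp : p.Prime := Fact.out
  obtain ⟨r, hr⟩ := exists_add_pow_prime_eq hp (X : ℤ[X]) 1
  have hderiv : (X + 1 : ℤ[X]) ^ (p - 1) = X ^ (p - 1) + derivative (X * r) := by
    refine mul_left_cancel₀ (Nat.cast_ne_zero.2 hp.ne_zero : (p : ℤ[X]) ≠ 0) ?_
    have h := congrArg derivative hr
    rw [one_pow, mul_one, mul_assoc] at h
    simpa only [derivative_add, derivative_X_pow, derivative_pow, derivative_X, derivative_one,
      derivative_natCast_mul, add_zero, mul_one, mul_add, map_natCast] using h
  refine ⟨aeval s (X * r), ?_⟩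
  have hmap : D K F (aeval s (X * r)) = aeval s (derivative (X * r)) • D K F s :=
    ((D K F).restrictScalars ℤ).map_aeval (X * r) s
  rw [hmap, ← add_smul, map_add, Derivation.map_one_eq_zero, add_zero]
  congr 1
  simpa only [map_pow, map_add, aeval_X, map_one] using congrArg (aeval s) hderiv

theorem inv_pow_smul_pow_sub_one_smul_D (s : F) :
    s⁻¹ ^ p • s ^ (p - 1) • D K F s = s⁻¹ • D K F s := by
  rcases eq_or_ne s 0 with rfl | hs
  · simp only [map_zero, smul_zero]
  · rw [smul_smul, inv_pow, ← congrArg (s ^ ·) (Nat.succ_pred_prime (Fact.out : p.Prime)), pow_succ]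
    congr 1
    simp only [Nat.pred_eq_sub_one]
    field_simp

variable [CharP F p]

theorem IsCartierAt.add {ω η ω' η' : Ω[F⁄K]} (h : IsCartierAt p x ω η)
    (h' : IsCartierAt p x ω' η') : IsCartierAt p x (ω + ω') (η + η') := by
  obtain ⟨f, rfl, rfl⟩ := h
  obtain ⟨g, rfl, rfl⟩ := h'
  refine ⟨fun i => f i + g i, ?_, (add_smul _ _ _).symm⟩
  simp only [add_pow_char, add_mul, Finset.sum_add_distrib, add_smul]

theorem IsCartierAt.neg {ω η : Ω[F⁄K]} (h : IsCartierAt p x ω η) : IsCartierAt p x (-ω) (-η) := by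
  have hneg := h.smul (-1)
  rwa [← frobenius_def, map_neg, map_one, neg_one_smul, neg_one_smul] at hneg

theorem IsCartierAt.sum {ι : Type*} {s : Finset ι} {ω η : ι → Ω[F⁄K]}
    (h : ∀ i ∈ s, IsCartierAt p x (ω i) (η i)) :
    IsCartierAt p x (∑ i ∈ s, ω i) (∑ i ∈ s, η i) := by
  classical
  induction s using Finset.induction_on with
  | empty => exact .zero
  | insert i s hi ih =>
    rw [Finset.sum_insert hi, Finset.sum_insert hi]
    exact (h i (Finset.mem_insert_self i s)).add
      (ih fun j hj => h j (Finset.mem_insert_of_mem hj))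

theorem IsCartierAt.eq_zero (hx : D K F x ≠ 0) {η : Ω[F⁄K]} (h : IsCartierAt p x 0 η) :
    η = 0 := by
  obtain ⟨f, h0, rfl⟩ := h
  rw [eq_zero_of_sum_pow_mul_pow_eq_zero p hx le_rfl
    ((smul_eq_zero.1 h0.symm).resolve_right hx) (p - 1)
    (Nat.pred_lt (Fact.out : p.Prime).ne_zero), zero_smul]

/-- Differentiation of a `p`-th power expansion produces no term in `x^{p-1}`. -/
theorem IsPGenerator.isCartierAt_D (hgen : IsPGenerator p x) (h : F) :
    IsCartierAt p x (D K F h) 0 := by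
  obtain ⟨g, rfl⟩ := hgen h
  obtain ⟨m, hm⟩ : ∃ m, p = m + 1 := ⟨p - 1, (Nat.succ_pred_prime Fact.out).symm⟩
  refine ⟨fun i => if i < m then ((i + 1 : ℕ) : F) * g (i + 1) else 0, ?_, by simp [hm]⟩
  rw [congrArg Finset.range hm, D_sum_pow_mul_pow, Finset.sum_range_succ]
  simp only [lt_irrefl, if_false]
  rw [zero_pow (by omega), zero_mul, add_zero]
  congr 1
  exact Finset.sum_congr rfl fun i hi => by rw [if_pos (Finset.mem_range.1 hi)]

theorem IsPGenerator.isCartierAt_add_one (hgen : IsPGenerator p x) {s : F}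
    (hs : IsCartierAt p x (s⁻¹ • D K F s) (s⁻¹ • D K F s)) :
    IsCartierAt p x ((s + 1)⁻¹ • D K F (s + 1)) ((s + 1)⁻¹ • D K F (s + 1)) := by
  obtain ⟨h, hh⟩ := exists_add_one_pow_smul_D_eq (K := K) (p := p) s
  have hpow : IsCartierAt p x (s ^ (p - 1) • D K F s) (D K F s) := by
    rcases eq_or_ne s 0 with rfl | hs0
    · simpa using IsCartierAt.zero
    · have := hs.smul s
      rwa [← inv_pow_smul_pow_sub_one_smul_D (p := p), smul_smul, ← mul_pow, mul_inv_cancel₀ hs0,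
        one_pow, one_smul, inv_pow_smul_pow_sub_one_smul_D, smul_smul, mul_inv_cancel₀ hs0,
        one_smul] at this
  have hsum := (hpow.add (hgen.isCartierAt_D h)).smul (s + 1)⁻¹
  rwa [← hh, inv_pow_smul_pow_sub_one_smul_D, add_zero, ← add_zero (D K F s),
    ← (D K F).map_one_eq_zero, ← map_add] at hsum

theorem IsCartierAt.inv_smul_D_mul {f g : F}
    (hf : IsCartierAt p x (f⁻¹ • D K F f) (f⁻¹ • D K F f))
    (hg : IsCartierAt p x (g⁻¹ • D K F g) (g⁻¹ • D K F g)) :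
    IsCartierAt p x ((f * g)⁻¹ • D K F (f * g)) ((f * g)⁻¹ • D K F (f * g)) := by
  rcases eq_or_ne f 0 with rfl | hf0
  · rwa [zero_mul]
  rcases eq_or_ne g 0 with rfl | hg0
  · rwa [mul_zero]
  rw [CartierCode.inv_smul_D_mul hf0 hg0]
  exact hf.add hg

theorem IsCartierAt.inv_smul_D_inv {f : F}
    (hf : IsCartierAt p x (f⁻¹ • D K F f) (f⁻¹ • D K F f)) :
    IsCartierAt p x (f⁻¹⁻¹ • D K F f⁻¹) (f⁻¹⁻¹ • D K F f⁻¹) := by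
  rw [inv_inv_smul_D_inv]
  exact hf.neg

/-- The functions whose logarithmic derivative is fixed by the Cartier operator computed with the
coordinate `x`. They form a field, as `f + g = g (f / g + 1)`. -/
def IsPGenerator.logFixed (K : Type*) [Field K] [Algebra K F] (hgen : IsPGenerator p x) :
    Subfield F where
  carrier := {f | IsCartierAt p x (f⁻¹ • D K F f) (f⁻¹ • D K F f)}
  zero_mem' := by simpa using IsCartierAt.zero
  one_mem' := by simpa using IsCartierAt.zero
  neg_mem' {f} hf := by simpa [inv_neg] using hf
  mul_mem' {f g} hf hg := IsCartierAt.inv_smul_D_mul hf hg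
  inv_mem' _ hf := IsCartierAt.inv_smul_D_inv hf
  add_mem' {f g} hf hg := by
    rcases eq_or_ne g 0 with rfl | hg0
    · rwa [add_zero]
    · rw [show f + g = g * (f * g⁻¹ + 1) by field_simp]
      exact IsCartierAt.inv_smul_D_mul hg
        (hgen.isCartierAt_add_one (IsCartierAt.inv_smul_D_mul hf (IsCartierAt.inv_smul_D_inv hg)))

theorem IsPGenerator.isCartierAt_inv_smul_D (hgen : IsPGenerator p x) (hx : x ≠ 0) (f : F) :
    IsCartierAt p x (f⁻¹ • D K F f) (f⁻¹ • D K F f) := by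
  obtain ⟨g, rfl⟩ := hgen f
  have hpow (y : F) : y ^ p ∈ hgen.logFixed K := by
    change IsCartierAt p x _ _
    rw [D_pow_char, smul_zero]
    exact .zero
  have hx' : x ∈ hgen.logFixed K := isCartierAt_inv_smul_D_self hx
  exact (sum_mem fun i _ => mul_mem (hpow (g i)) (pow_mem hx' i) : _ ∈ hgen.logFixed K)

end CartierOperator

section LogarithmicForms

variable {K F : Type*} [Field K] [Field F] [Algebra K F]

variable (K F) in
/-- The logarithmic differential `f ↦ df / f`. -/
noncomputable def dlog : Additive Fˣ →+ Ω[F⁄K] :=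
  AddMonoidHom.mk' (fun f => (f.toMul : F)⁻¹ • D K F (f.toMul : F)) fun f g =>
    inv_smul_D_mul f.toMul.ne_zero g.toMul.ne_zero

theorem dlog_ofMul (f : Fˣ) : dlog K F (.ofMul f) = (f : F)⁻¹ • D K F (f : F) := rfl

theorem dlog_ofMul_eq_zero_iff {f : Fˣ} : dlog K F (.ofMul f) = 0 ↔ D K F (f : F) = 0 := by
  rw [dlog_ofMul, smul_eq_zero_iff_right (inv_ne_zero f.ne_zero)]

variable {p : ℕ} [Fact p.Prime] [CharP F p]

theorem IsFunctionField.isCartier_dlog [PerfectField K] (hF : IsFunctionField K F)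
    (f : Additive Fˣ) : IsCartier p (dlog K F f) (dlog K F f) := fun x hx =>
  (hF.isPGenerator p hx).isCartierAt_inv_smul_D (by rintro rfl; exact hx (map_zero _)) _

theorem IsFunctionField.isCartierIter_dlog [PerfectField K] (hF : IsFunctionField K F)
    (f : Additive Fˣ) (e : ℕ) : IsCartierIter p e (dlog K F f) (dlog K F f) := by
  induction e with
  | zero => rfl
  | succ e ih => exact ⟨_, hF.isCartier_dlog f, ih⟩

theorem IsCartierIter.sum {ι : Type*} {s : Finset ι} {e : ℕ} {ω η : ι → Ω[F⁄K]}
    (h : ∀ i ∈ s, IsCartierIter p e (ω i) (η i)) :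
    IsCartierIter p e (∑ i ∈ s, ω i) (∑ i ∈ s, η i) := by
  classical
  induction s using Finset.induction_on with
  | empty => exact .zero e
  | insert i s hi ih =>
    rw [Finset.sum_insert hi, Finset.sum_insert hi]
    exact (h i (Finset.mem_insert_self i s)).add
      (ih fun j hj => h j (Finset.mem_insert_of_mem hj))

theorem exists_intCast_eq_of_forall_pow_eq_self {k ι : Type*} [Field k] [CharP k p] {s : Finset ι}
    {d : ι → k} (hd : ∀ i ∈ s, d i ^ p = d i) : ∃ m : ι → ℤ, ∀ i ∈ s, (m i : k) = d i := by
  have hle : (⊥ : Subfield k) ≤ (ZMod.castHom (dvd_refl p) k).fieldRange := bot_le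
  have hint (i : ι) : ∃ m : ℤ, i ∈ s → (m : k) = d i := by
    by_cases hi : i ∈ s
    · obtain ⟨z, hz⟩ := hle ((Subfield.mem_bot_iff_pow_eq_self k p).2 (hd i hi))
      obtain ⟨m, rfl⟩ := ZMod.intCast_surjective z
      exact ⟨m, fun _ => by rw [← hz, map_intCast]⟩
    · exact ⟨0, fun h => absurd h hi⟩
  choose m hm using hint
  exact ⟨m, hm⟩

theorem sum_smul_eq_zero_of_sum_pow_smul_eq_zero {x : F} (hx : D K F x ≠ 0) {ι : Type*}
    {s : Finset ι} {ω : ι → Ω[F⁄K]} (hω : ∀ i ∈ s, IsCartierAt p x (ω i) (ω i)) {d : ι → K}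
    (hd : ∑ i ∈ s, d i ^ p • ω i = 0) : ∑ i ∈ s, d i • ω i = 0 := by
  refine IsCartierAt.eq_zero (p := p) hx ?_
  rw [← hd]
  refine IsCartierAt.sum fun i hi => ?_
  have h := (hω i hi).smul (algebraMap K F (d i))
  rwa [← map_pow, algebraMap_smul, algebraMap_smul] at h

/-- Artin's argument: in a relation with one coefficient equal to `1`, subtracting its image under
the Cartier operator gives a shorter relation, so that all coefficients are fixed by the Frobenius,
that is, integers modulo `p`. -/
theorem linearIndependent_of_isCartierAt_self [PerfectField K] {x : F} (hx : D K F x ≠ 0)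
    {ι : Type*} {ω : ι → Ω[F⁄K]} (hω : ∀ i, IsCartierAt p x (ω i) (ω i))
    (hind : ∀ (s : Finset ι) (m : ι → ℤ), ∑ i ∈ s, m i • ω i = 0 → ∀ i ∈ s, (p : ℤ) ∣ m i) :
    LinearIndependent K ω := by
  classical
  have : CharP K p := (algebraMap K F).charP (algebraMap K F).injective p
  rw [linearIndependent_iff']
  intro s
  induction s using Finset.induction_on with
  | empty => simp
  | insert i s hi ih =>
    intro c hc
    have hci : c i = 0 := by
      by_contra hci
      have hroot (j : ι) : ∃ d : K, d ^ p = (c i)⁻¹ * c j :=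
        (PerfectRing.bijective_frobenius (R := K) (p := p)).2 _
      choose d hd using hroot
      have hdi : d i = 1 := frobenius_inj K p (by
        rw [frobenius_def, hd, inv_mul_cancel₀ hci, map_one])
      have hpow : ∑ j ∈ insert i s, d j ^ p • ω j = 0 := by
        simp only [hd, mul_smul, ← Finset.smul_sum, hc, smul_zero]
      have hroot := sum_smul_eq_zero_of_sum_pow_smul_eq_zero hx (fun j _ => hω j) hpow
      have hfixed : ∀ j ∈ s, d j ^ p - d j = 0 := ih _ (by
        simpa only [Finset.sum_insert hi, hdi, one_pow, add_sub_add_left_eq_sub, sub_zero, sub_smul,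
          Finset.sum_sub_distrib] using congrArg₂ (· - ·) hpow hroot)
      obtain ⟨m, hm⟩ := exists_intCast_eq_of_forall_pow_eq_self (Finset.forall_mem_insert _ _ _ |>.2
        ⟨by rw [hdi, one_pow], fun j hj => sub_eq_zero.1 (hfixed j hj)⟩)
      have hmi : (p : ℤ) ∣ m i := hind (insert i s) m (by
        rw [← hroot]
        exact Finset.sum_congr rfl fun j hj => by rw [← hm j hj, Int.cast_smul_eq_zsmul]) i
        (Finset.mem_insert_self i s)
      rw [← CharP.intCast_eq_zero_iff K p, hm i (Finset.mem_insert_self i s), hdi] at hmi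
      exact one_ne_zero hmi
    rw [Finset.sum_insert hi, hci, zero_smul, zero_add] at hc
    exact Finset.forall_mem_insert _ _ _ |>.2 ⟨hci, ih c hc⟩

theorem IsFunctionField.linearIndependent_dlog [PerfectField K] (hF : IsFunctionField K F)
    {ι : Type*} {f : ι → Fˣ}
    (hind : ∀ (s : Finset ι) (m : ι → ℤ) (g : F),
      ((∏ i ∈ s, f i ^ m i : Fˣ) : F) = g ^ p → ∀ i ∈ s, (p : ℤ) ∣ m i) :
    LinearIndependent K fun i => dlog K F (.ofMul (f i)) := by
  obtain ⟨x, hx⟩ := hF.exists_D_ne_zero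
  refine linearIndependent_of_isCartierAt_self (p := p) hx
    (fun i => hF.isCartier_dlog (.ofMul (f i)) x hx) fun s m hm => ?_
  have hD : dlog K F (.ofMul (∏ i ∈ s, f i ^ m i)) = 0 := by
    rw [ofMul_prod, map_sum, ← hm]
    exact Finset.sum_congr rfl fun i _ => by rw [ofMul_zpow, map_zsmul]
  obtain ⟨g, hg⟩ := (hF.isPGenerator p hx).eq_pow_of_D_eq_zero p hx (dlog_ofMul_eq_zero_iff.1 hD)
  exact hind s m g hg

end LogarithmicForms

section Places

theorem valuation_le_valuation_sum {R Γ₀ ι : Type*} [Ring R]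
    [LinearOrderedCommGroupWithZero Γ₀] (v : Valuation R Γ₀) {s : Finset ι} {f : ι → R}
    (hf : ∀ i ∈ s, ∀ j ∈ s, v (f i) ≠ 0 → v (f i) = v (f j) → i = j) {i : ι} (hi : i ∈ s) :
    v (f i) ≤ v (∑ j ∈ s, f j) := by
  classical
  obtain ⟨j, hj, hmax⟩ := s.exists_max_image (fun i => v (f i)) ⟨i, hi⟩
  by_cases hj0 : v (f j) = 0
  · exact (hmax i hi).trans (hj0 ▸ zero_le)
  · rw [v.map_sum_eq_of_lt hj fun l hl => ?_]
    · exact hmax i hi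
    · rw [Finset.mem_sdiff, Finset.mem_singleton] at hl
      exact (hmax l hl.1).lt_of_ne fun h => hl.2 (hf j hj l hl.1 hj0 h.symm).symm

variable {K F : Type*} [Field K] [Field F] [Algebra K F]

theorem Place.val_le_one_iff (P : Place K F) {f : F} : P.val f ≤ 1 ↔ f ∈ P.ring := by
  constructor
  · intro h
    obtain ⟨a, rfl⟩ := IsDiscreteValuationRing.exists_lift_of_le_one (A := P.ring) h
    exact a.2
  · exact fun h => IsDedekindDomain.HeightOneSpectrum.valuation_le_one
      (IsDiscreteValuationRing.maximalIdeal P.ring) ⟨f, h⟩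

theorem Place.exists_isUniformizer (P : Place K F) : ∃ t, P.IsUniformizer t :=
  IsDedekindDomain.HeightOneSpectrum.valuation_exists_uniformizer F _

/-- The order of vanishing `v_P(f)`, written additively. The junk value `v_P(0) = 0` replaces the
usual `∞`. -/
noncomputable def Place.ord (P : Place K F) (f : F) : ℤ := -WithZero.log (P.val f)

variable {P : Place K F}

theorem Place.val_eq_exp {f : F} (hf : f ≠ 0) : P.val f = WithZero.exp (-P.ord f) := by
  rw [Place.ord, neg_neg, WithZero.exp_log ((Valuation.ne_zero_iff _).2 hf)]

theorem Place.val_le_exp_iff {f : F} (hf : f ≠ 0) (m : ℤ) :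
    P.val f ≤ WithZero.exp (-m) ↔ m ≤ P.ord f := by
  rw [Place.val_eq_exp hf, WithZero.exp_le_exp, neg_le_neg_iff]

theorem Place.ord_zero : P.ord (0 : F) = 0 := by simp [Place.ord]

theorem Place.ord_mul {f g : F} (hf : f ≠ 0) (hg : g ≠ 0) :
    P.ord (f * g) = P.ord f + P.ord g := by
  rw [Place.ord, map_mul, WithZero.log_mul ((Valuation.ne_zero_iff _).2 hf)
    ((Valuation.ne_zero_iff _).2 hg), neg_add, Place.ord, Place.ord]

theorem Place.ord_inv (f : F) : P.ord f⁻¹ = -P.ord f := by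
  rw [Place.ord, map_inv₀, WithZero.log_inv, Place.ord]

theorem Place.ord_zpow (f : F) (n : ℤ) : P.ord (f ^ n) = n * P.ord f := by
  simp [Place.ord, map_zpow₀, WithZero.log_zpow]

theorem Place.ord_pow (f : F) (n : ℕ) : P.ord (f ^ n) = n * P.ord f :=
  mod_cast P.ord_zpow f n

theorem Place.mem_ring_iff {f : F} (hf : f ≠ 0) : f ∈ P.ring ↔ 0 ≤ P.ord f := by
  rw [← P.val_le_one_iff, ← Place.val_le_exp_iff hf 0, neg_zero, WithZero.exp_zero]

theorem Place.mem_ring_of_ord_nonneg {f : F} (hf : 0 ≤ P.ord f) : f ∈ P.ring := by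
  rcases eq_or_ne f 0 with rfl | hf0
  · exact zero_mem _
  · exact (Place.mem_ring_iff hf0).2 hf

theorem Place.ord_nonneg {f : F} (hf : f ∈ P.ring) : 0 ≤ P.ord f := by
  rcases eq_or_ne f 0 with rfl | hf0
  · exact Place.ord_zero.ge
  · exact (Place.mem_ring_iff hf0).1 hf

theorem Place.isUniformizer_iff {t : F} : P.IsUniformizer t ↔ P.ord t = 1 := by
  constructor
  · intro h
    rw [Place.ord, h, WithZero.log_exp, neg_neg]
  · intro h
    have ht : t ≠ 0 := by
      rintro rfl
      simp [Place.ord_zero] at h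
    rw [Place.IsUniformizer, Place.val_eq_exp ht, h]

theorem Place.IsUniformizer.ne_zero {t : F} (ht : P.IsUniformizer t) : t ≠ 0 := by
  rintro rfl
  simp [Place.isUniformizer_iff, Place.ord_zero] at ht

theorem Place.IsUniformizer.mem_ring {t : F} (ht : P.IsUniformizer t) : t ∈ P.ring :=
  Place.mem_ring_of_ord_nonneg ((Place.isUniformizer_iff.1 ht).symm ▸ zero_le_one)

theorem Place.IsUniformizer.ord_pow_mul_pow {t : F} (ht : P.IsUniformizer t) {g : F} (hg : g ≠ 0)
    (m n : ℕ) : P.ord (g ^ m * t ^ n) = m * P.ord g + n := by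
  rw [Place.ord_mul (pow_ne_zero _ hg) (pow_ne_zero _ ht.ne_zero), Place.ord_pow, Place.ord_pow,
    Place.isUniformizer_iff.1 ht, mul_one]

theorem Place.ring_injective :
    Function.Injective (Place.ring : Place K F → ValuationSubring F) := by
  rintro ⟨⟩ ⟨⟩ rfl
  rfl

theorem Place.eq_of_ring_le {P Q : Place K F} (h : Q.ring ≤ P.ring) : P = Q := by
  refine Place.ring_injective (ValuationSubring.eq_of_le_of_ne_top _ h fun htop => ?_).symm
  obtain ⟨t, ht⟩ := P.exists_isUniformizer
  have hinv : t⁻¹ ∈ P.ring := htop ▸ ValuationSubring.mem_top _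
  simpa [Place.ord_inv, Place.isUniformizer_iff.1 ht] using Place.ord_nonneg hinv

variable (p : ℕ) [Fact p.Prime]

theorem Place.IsUniformizer.mem_ring_of_sum_pow_mul_pow_mem {t : F} (ht : P.IsUniformizer t)
    {g : ℕ → F} (h : ∑ i ∈ Finset.range p, g i ^ p * t ^ i ∈ P.ring) {i : ℕ} (hi : i < p) :
    g i ∈ P.ring := by
  have hp : p ≠ 0 := (Fact.out : p.Prime).ne_zero
  have hterm : g i ^ p * t ^ i ∈ P.ring := by
    rw [← P.val_le_one_iff] at h ⊢
    refine (valuation_le_valuation_sum P.val (fun j hj l hl hne heq => ?_)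
      (Finset.mem_range.2 hi)).trans h
    have hg {m : ℕ} (hm : P.val (g m ^ p * t ^ m) ≠ 0) : g m ≠ 0 := by
      intro h0
      simp [h0, hp] at hm
    have hord : P.ord (g j ^ p * t ^ j) = P.ord (g l ^ p * t ^ l) := by
      rw [Place.ord, heq, Place.ord]
    rw [ht.ord_pow_mul_pow (hg hne), ht.ord_pow_mul_pow (hg (heq ▸ hne))] at hord
    have hmod := congrArg (· % (p : ℤ)) hord
    simp only [Int.mul_add_emod_self_left] at hmod
    rw [Int.emod_eq_of_lt (by omega) (mod_cast Finset.mem_range.1 hj),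
      Int.emod_eq_of_lt (by omega) (mod_cast Finset.mem_range.1 hl)] at hmod
    exact_mod_cast hmod
  rcases eq_or_ne (g i) 0 with h0 | h0
  · exact h0 ▸ zero_mem _
  refine Place.mem_ring_of_ord_nonneg ?_
  have hnonneg := Place.ord_nonneg hterm
  rw [ht.ord_pow_mul_pow h0] at hnonneg
  by_contra! hneg
  nlinarith

variable [CharP F p] [PerfectField K]
include p

theorem IsFunctionField.D_ne_zero_of_isUniformizer (hF : IsFunctionField K F) {t : F}
    (ht : P.IsUniformizer t) : D K F t ≠ 0 := by
  intro h
  obtain ⟨x, hx⟩ := hF.exists_D_ne_zero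
  obtain ⟨g, rfl⟩ := (hF.isPGenerator p hx).eq_pow_of_D_eq_zero p hx h
  have hord := Place.isUniformizer_iff.1 ht
  rw [Place.ord_pow] at hord
  exact (Fact.out : p.Prime).ne_one
    (Nat.dvd_one.1 (Int.natCast_dvd_natCast.1 ⟨_, by simpa using hord.symm⟩))

theorem IsFunctionField.exists_D_eq_smul (hF : IsFunctionField K F) {t : F}
    (ht : P.IsUniformizer t) {h : F} (hh : h ∈ P.ring) :
    ∃ g ∈ P.ring, D K F h = g • D K F t := by
  obtain ⟨g, rfl⟩ := hF.isPGenerator p (hF.D_ne_zero_of_isUniformizer p ht) h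
  have hg {i : ℕ} := ht.mem_ring_of_sum_pow_mul_pow_mem p hh (i := i)
  have hD := D_sum_pow_mul_pow p g t (p - 1) (K := K)
  rw [Nat.sub_add_cancel (Fact.out : p.Prime).one_le] at hD
  refine ⟨_, ?_, hD⟩
  refine sum_mem fun i hi => mul_mem (pow_mem (mul_mem (_root_.natCast_mem _ _) (hg ?_)) p)
    (pow_mem ht.mem_ring _)
  have := Finset.mem_range.1 hi
  omega

theorem IsFunctionField.exists_dlog_eq (hF : IsFunctionField K F) {t : F} (ht : P.IsUniformizer t)
    (f : Fˣ) : ∃ g ∈ P.ring, dlog K F (.ofMul f) = ((P.ord (f : F) : F) * t⁻¹ + g) • D K F t := by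
  set u : Fˣ := f * Units.mk0 t ht.ne_zero ^ (-P.ord (f : F))
  have hordu : P.ord (u : F) = 0 := by
    rw [Units.val_mul, Units.val_zpow_eq_zpow_val, Units.val_mk0,
      Place.ord_mul f.ne_zero (zpow_ne_zero _ ht.ne_zero), Place.ord_zpow,
      Place.isUniformizer_iff.1 ht]
    ring
  obtain ⟨g, hg, hDu⟩ := hF.exists_D_eq_smul p ht (Place.mem_ring_of_ord_nonneg hordu.ge)
  refine ⟨(u : F)⁻¹ * g, mul_mem (Place.mem_ring_of_ord_nonneg ?_) hg, ?_⟩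
  · rw [Place.ord_inv, hordu, neg_zero]
  · have hfu : f = u * Units.mk0 t ht.ne_zero ^ P.ord (f : F) := by simp [u]
    conv_lhs => rw [hfu]
    rw [ofMul_mul, ofMul_zpow, map_add, map_zsmul, dlog_ofMul, dlog_ofMul, hDu, Units.val_mk0,
      add_comm, add_smul, mul_smul, mul_smul, Int.cast_smul_eq_zsmul]

end Places

section AffineRing

open Polynomial

variable {K F : Type*} [Field K] [Field F] [Algebra K F]

theorem isFractionRing_polynomial_adjoin {x : F} (hx : Transcendental K x) :
    letI : Algebra K[X] K⟮x⟯ := (aeval (AdjoinSimple.gen K x)).toAlgebra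
    IsFractionRing K[X] K⟮x⟯ := by
  let : Algebra K[X] K⟮x⟯ := (aeval (AdjoinSimple.gen K x)).toAlgebra
  exact IsLocalization.isLocalization_of_algEquiv (nonZeroDivisors K[X])
    (AlgEquiv.ofRingEquiv (f := (RatFunc.algEquivOfTranscendental x hx).toRingEquiv)
      (RatFunc.algEquivOfTranscendental_algebraMap x hx))

variable (K) in
/-- The integral closure of `K[x]` in `F`: the functions which are regular wherever `x` is. -/
noncomputable def affineRing (x : F) : Subalgebra K F :=
  letI : Algebra K[X] F := (aeval (R := K) x).toAlgebra
  { integralClosure K[X] F with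
    algebraMap_mem' := fun c => by
      have hc : algebraMap K[X] F (C c) = algebraMap K F c := aeval_C x c
      exact hc ▸ isIntegral_algebraMap }

theorem aeval_mem_affineRing (x : F) (r : K[X]) : aeval x r ∈ affineRing K x :=
  letI : Algebra K[X] F := (aeval (R := K) x).toAlgebra
  (integralClosure K[X] F).algebraMap_mem r

theorem self_mem_affineRing (x : F) : x ∈ affineRing K x := by
  simpa using aeval_mem_affineRing (K := K) x X

variable [PerfectField K]

theorem IsFunctionField.exists_fractionField (hF : IsFunctionField K F) {x : F}
    (hx : D K F x ≠ 0) :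
    letI : Algebra K[X] F := (aeval (R := K) x).toAlgebra
    ∃ (E : IntermediateField K F) (_ : Algebra K[X] E), IsScalarTower K[X] E F ∧
      IsFractionRing K[X] E ∧ FiniteDimensional E F ∧ Algebra.IsSeparable E F := by
  let : Algebra K[X] F := (aeval (R := K) x).toAlgebra
  let : Algebra K[X] K⟮x⟯ := (aeval (AdjoinSimple.gen K x)).toAlgebra
  exact ⟨K⟮x⟯, inferInstance,
    IsScalarTower.of_algebraMap_eq fun r => aeval_algebraMap_apply F (AdjoinSimple.gen K x) r,
    isFractionRing_polynomial_adjoin (hF.transcendental_of_D_ne_zero hx), hF.finite_adjoin hx,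
    hF.isSeparable_adjoin hx⟩

theorem IsFunctionField.isDedekindDomain_affineRing (hF : IsFunctionField K F) {x : F}
    (hx : D K F x ≠ 0) : IsDedekindDomain (affineRing K x) := by
  let : Algebra K[X] F := (aeval (R := K) x).toAlgebra
  obtain ⟨E, _, _, _, _, _⟩ := hF.exists_fractionField hx
  exact IsIntegralClosure.isDedekindDomain K[X] E F (integralClosure K[X] F)

theorem IsFunctionField.isFractionRing_affineRing (hF : IsFunctionField K F) {x : F}
    (hx : D K F x ≠ 0) : IsFractionRing (affineRing K x) F := by
  let : Algebra K[X] F := (aeval (R := K) x).toAlgebra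
  obtain ⟨E, _, _, _, _, _⟩ := hF.exists_fractionField hx
  exact IsIntegralClosure.isFractionRing_of_finite_extension K[X] E F (integralClosure K[X] F)

theorem IsFunctionField.finite_classGroup_affineRing [Finite K] (hF : IsFunctionField K F) {x : F}
    (hx : D K F x ≠ 0) [IsDedekindDomain (affineRing K x)] :
    Finite (ClassGroup (affineRing K x)) := by
  let : Algebra K[X] F := (aeval (R := K) x).toAlgebra
  obtain ⟨E, _, _, _, _, _⟩ := hF.exists_fractionField hx
  classical
  let := Fintype.ofFinite K
  have := ClassGroup.fintypeOfAdmissibleOfFinite (S := integralClosure K[X] F) E F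
    (cardPowDegreeIsAdmissible : AbsoluteValue.IsAdmissible
      (cardPowDegree : AbsoluteValue K[X] ℤ))
  exact Finite.of_fintype (ClassGroup (integralClosure K[X] F))

theorem IsFunctionField.exists_affineRing_le_span (hF : IsFunctionField K F) {x : F}
    (hx : D K F x ≠ 0) : ∃ Y : Finset F, (Y : Set F) ⊆ affineRing K x ∧
      Subalgebra.toSubmodule (affineRing K x) ≤
        Submodule.span K (Set.image2 (fun (j : ℕ) y => x ^ j * y) Set.univ Y) := by
  let : Algebra K[X] F := (aeval (R := K) x).toAlgebra
  obtain ⟨E, _, _, _, _, _⟩ := hF.exists_fractionField hx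
  have hfin : Module.Finite K[X] (integralClosure K[X] F) := IsIntegralClosure.finite K[X] E F _
  obtain ⟨Y, hY⟩ : (Subalgebra.toSubmodule (integralClosure K[X] F)).FG :=
    Module.Finite.iff_fg.1 hfin
  refine ⟨Y, fun y hy => hY.le (Submodule.subset_span hy), fun a ha => ?_⟩
  obtain ⟨r, -, rfl⟩ := Submodule.mem_span_finset.1 (hY.ge ha)
  refine sum_mem fun y hy => ?_
  change aeval x (r y) * y ∈ _
  rw [aeval_eq_sum_range, Finset.sum_mul]
  refine sum_mem fun j _ => ?_
  rw [smul_mul_assoc]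
  exact Submodule.smul_mem _ _ (Submodule.subset_span ⟨j, trivial, y, hy, rfl⟩)

omit [PerfectField K] in
theorem inv_notMem_affineRing {x : F} (hx : Transcendental K x) : x⁻¹ ∉ affineRing K x := by
  intro hinv
  let : Algebra K[X] F := (aeval (R := K) x).toAlgebra
  have hx0 : x ≠ 0 := by
    rintro rfl
    exact hx isAlgebraic_zero
  have : IsLocalHom (algebraMap K[X] (integralClosure K[X] F)) :=
    (algebraMap_isIntegral_iff.2 inferInstance).isLocalHom fun r s h =>
      transcendental_iff_injective.1 hx (congrArg Subtype.val h)
  refine not_isUnit_X (isUnit_of_map_unit (algebraMap K[X] (integralClosure K[X] F)) X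
    (IsUnit.of_mul_eq_one ⟨x⁻¹, hinv⟩ (Subtype.ext ?_)))
  exact (congrArg (· * x⁻¹) (aeval_X x)).trans (mul_inv_cancel₀ hx0)

end AffineRing

section PlacesOverSubalgebra

variable {K F : Type*} [Field K] [Field F] [Algebra K F]

/-- The local ring at a place as a `K`-subalgebra, to be compared with affine coordinate rings. -/
def Place.subalgebra (P : Place K F) : Subalgebra K F :=
  { P.ring.toSubring with algebraMap_mem' := P.algebraMap_mem }

variable {P Q : Place K F} {A : Subalgebra K F}

/-- The contraction of the maximal ideal at `P` to a subalgebra `A` regular at `P`. -/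
def Place.under (P : Place K F) (hP : A ≤ P.subalgebra) : Ideal A :=
  (IsLocalRing.maximalIdeal P.ring).comap (A.toSubring.subtype.codRestrict P.ring fun a => hP a.2)

instance (hP : A ≤ P.subalgebra) : (P.under hP).IsPrime := Ideal.IsPrime.comap _

theorem Place.mem_under_iff (hP : A ≤ P.subalgebra) {a : A} :
    a ∈ P.under hP ↔ P.val (a : F) < 1 :=
  ((IsDiscreteValuationRing.maximalIdeal P.ring).valuation_lt_one_iff_mem
    (⟨a, hP a.2⟩ : P.ring)).symm

theorem Place.notMem_under_iff (hP : A ≤ P.subalgebra) {a : A} :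
    a ∉ P.under hP ↔ P.val (a : F) = 1 := by
  rw [Place.mem_under_iff, not_lt, (P.val_le_one_iff.2 (hP a.2)).ge_iff_eq]

theorem Place.ord_pos_of_mem_under (hP : A ≤ P.subalgebra) {a : A} (ha : (a : F) ≠ 0)
    (h : a ∈ P.under hP) : 0 < P.ord (a : F) := by
  rwa [Place.mem_under_iff, Place.val_eq_exp ha, ← WithZero.exp_zero, WithZero.exp_lt_exp,
    neg_lt_zero] at h

theorem Place.ord_eq_zero_of_notMem_under (hP : A ≤ P.subalgebra) {a : A}
    (h : a ∉ P.under hP) : P.ord (a : F) = 0 := by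
  rw [Place.ord, (Place.notMem_under_iff hP).1 h, WithZero.log_one, neg_zero]

variable [IsFractionRing A F]

theorem Place.under_ne_bot (hP : A ≤ P.subalgebra) : P.under hP ≠ ⊥ := by
  intro hbot
  obtain ⟨t, ht⟩ := P.exists_isUniformizer
  obtain ⟨a, b, hb, hab⟩ := IsFractionRing.div_surjective A t⁻¹
  have hb' : P.val (b : F) = 1 := by
    rw [← Place.notMem_under_iff hP, hbot]
    exact nonZeroDivisors.ne_zero hb
  have hinv : t⁻¹ ∈ P.ring := by
    rw [← P.val_le_one_iff, ← hab]
    change P.val ((a : F) / b) ≤ 1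
    rw [map_div₀, hb', div_one]
    exact P.val_le_one_iff.2 (hP a.2)
  simpa [Place.ord_inv, Place.isUniformizer_iff.1 ht] using Place.ord_nonneg hinv

theorem Place.ord_pos_of_under_pow_eq_span (hP : A ≤ P.subalgebra) {h : ℕ} (hh : h ≠ 0) {f : A}
    (hf : P.under hP ^ h = Ideal.span {f}) : (f : F) ≠ 0 ∧ 0 < P.ord (f : F) := by
  have hf0 : (f : F) ≠ 0 := by
    intro h0
    rw [show f = 0 from Subtype.ext h0, Ideal.span_singleton_zero] at hf
    exact pow_ne_zero h (Place.under_ne_bot hP) hf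
  exact ⟨hf0, Place.ord_pos_of_mem_under hP hf0
    (Ideal.pow_le_self hh (hf ▸ Ideal.mem_span_singleton_self f))⟩

variable [IsDedekindDomain A]

/-- The point of `Spec A` under the place `P`. -/
def Place.underSpec (P : Place K F) (hP : A ≤ P.subalgebra) :
    IsDedekindDomain.HeightOneSpectrum A :=
  ⟨P.under hP, inferInstance, Place.under_ne_bot hP⟩

theorem Place.exists_mul_eq (hP : A ≤ P.subalgebra) {g : F} (hg : g ∈ P.ring) :
    ∃ a b : A, P.val (b : F) = 1 ∧ g * b = a := by
  obtain ⟨n, d, h | h⟩ := (P.underSpec hP).exists_primeCompl_mul_eq_or_mul_eq (K := F) g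
  · exact ⟨n, d, (Place.notMem_under_iff hP).1 d.2, h⟩
  · refine ⟨d, n, (P.val_le_one_iff.2 (hP n.2)).antisymm ?_, h⟩
    calc 1 = P.val g * P.val (n : F) := by
          rw [← map_mul]
          exact ((Place.notMem_under_iff hP).1 d.2).symm.trans (congrArg P.val h.symm)
      _ ≤ 1 * P.val (n : F) := by gcongr; exact P.val_le_one_iff.2 hg
      _ = P.val (n : F) := one_mul _

theorem Place.eq_of_under_eq (hP : A ≤ P.subalgebra) (hQ : A ≤ Q.subalgebra)
    (h : P.under hP = Q.under hQ) : P = Q := by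
  refine Place.eq_of_ring_le fun g hg => ?_
  obtain ⟨a, b, hb, hab⟩ := Place.exists_mul_eq hQ hg
  rw [← Place.notMem_under_iff hQ, ← h, Place.notMem_under_iff] at hb
  rw [← P.val_le_one_iff]
  calc P.val g = P.val (a : F) := by rw [← hab, map_mul, hb, mul_one]
    _ ≤ 1 := P.val_le_one_iff.2 (hP a.2)

theorem finite_ord_pos_of_le_subalgebra {z : F} (hz : z ≠ 0) :
    {P : Place K F | A ≤ P.subalgebra ∧ 0 < P.ord z}.Finite := by
  obtain ⟨a, b, -, hab⟩ := IsFractionRing.div_surjective A z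
  replace hab : (a : F) / b = z := hab
  obtain ⟨ha, hb⟩ := div_ne_zero_iff.1 (hab ▸ hz)
  have hspan : Ideal.span {a} ≠ ⊥ := by
    rw [Ne, Ideal.span_singleton_eq_bot]
    exact fun h => ha (congrArg Subtype.val h)
  have hinj : Function.Injective
      fun P : {P : Place K F // A ≤ P.subalgebra} => P.1.underSpec P.2 := fun P Q hPQ =>
    Subtype.ext (Place.eq_of_under_eq P.2 Q.2
      (congrArg IsDedekindDomain.HeightOneSpectrum.asIdeal hPQ))
  refine (((Ideal.finite_factors hspan).preimage hinj.injOn).image Subtype.val).subset ?_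
  rintro P ⟨hP, hord⟩
  refine ⟨⟨P, hP⟩, Ideal.dvd_span_singleton.2 ?_, rfl⟩
  by_contra hmem
  have hordb := Place.ord_nonneg (hP b.2)
  rw [← hab, div_eq_mul_inv, Place.ord_mul ha (inv_ne_zero hb), Place.ord_inv,
    Place.ord_eq_zero_of_notMem_under hP hmem] at hord
  omega

theorem Place.exists_under_pow_eq_span [Finite (ClassGroup A)] (hP : A ≤ P.subalgebra) :
    ∃ h ≠ 0, ∃ f : A, P.under hP ^ h = Ideal.span {f} := by
  let q : nonZeroDivisors (Ideal A) :=
    ⟨P.under hP, mem_nonZeroDivisors_of_ne_zero (Place.under_ne_bot hP)⟩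
  have hq : ClassGroup.mk0 q ^ Nat.card (ClassGroup A) = 1 := pow_card_eq_one'
  rw [← map_pow, ClassGroup.mk0_eq_one_iff] at hq
  exact ⟨_, Nat.card_pos.ne', hq.principal⟩

theorem Place.ord_eq_zero_of_under_pow_eq_span (hP : A ≤ P.subalgebra) {h : ℕ} {f : A}
    (hf : P.under hP ^ h = Ideal.span {f}) (hQ : A ≤ Q.subalgebra) (hPQ : P ≠ Q) :
    Q.ord (f : F) = 0 := by
  refine Place.ord_eq_zero_of_notMem_under hQ fun hmem => hPQ (Place.eq_of_under_eq hP hQ ?_)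
  refine ((inferInstance : (P.under hP).IsPrime).isMaximal (Place.under_ne_bot hP)).eq_of_le
    (Ideal.IsPrime.ne_top inferInstance) (Ideal.IsPrime.le_of_pow_le (n := h) ?_)
  rwa [hf, Ideal.span_singleton_le_iff_mem]

/-- The place of `F` defined by a prime ideal of `A`. -/
noncomputable def placeOfPrime (v : IsDedekindDomain.HeightOneSpectrum A) : Place K F where
  ring := v.valuationSubringAtPrime F
  algebraMap_mem c := by
    rw [IsDedekindDomain.HeightOneSpectrum.valuationSubringAtPrime_eq_valuationSubring]
    exact v.valuation_le_one (algebraMap K A c)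
  isDVR := by
    have : IsLocalization.AtPrime (v.valuationSubringAtPrime F) v.asIdeal :=
      inferInstanceAs (IsLocalization v.asIdeal.primeCompl (v.valuationSubringAtPrime F))
    exact IsLocalization.AtPrime.isDiscreteValuationRing_of_dedekind_domain A v.ne_bot _

theorem placeOfPrime_ord_pos (v : IsDedekindDomain.HeightOneSpectrum A) {a : A} (ha : (a : F) ≠ 0)
    (hav : a ∈ v.asIdeal) : 0 < (placeOfPrime v : Place K F).ord (a : F) := by
  by_contra! hord
  have hinv : (a : F)⁻¹ ∈ v.valuationSubringAtPrime F :=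
    Place.mem_ring_of_ord_nonneg (P := placeOfPrime v) (by rw [Place.ord_inv]; omega)
  rw [IsDedekindDomain.HeightOneSpectrum.valuationSubringAtPrime_eq_valuationSubring,
    Valuation.mem_valuationSubring_iff, map_inv₀] at hinv
  exact hinv.not_gt ((one_lt_inv₀ (zero_lt_iff.2 ((Valuation.ne_zero_iff _).2 ha))).2
    ((v.valuation_lt_one_iff_mem (K := F) a).2 hav))

theorem exists_ord_pos_of_inv_notMem {a : F} (ha : a ∈ A) (hinv : a⁻¹ ∉ A) :
    ∃ P : Place K F, 0 < P.ord a := by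
  have ha0 : a ≠ 0 := by
    rintro rfl
    rw [inv_zero] at hinv
    exact hinv ha
  have hunit : ¬ IsUnit (⟨a, ha⟩ : A) := by
    intro h
    obtain ⟨b, hb⟩ := h.exists_right_inv
    exact hinv (inv_eq_of_mul_eq_one_right (congrArg Subtype.val hb) ▸ b.2)
  obtain ⟨M, hM, haM⟩ := exists_max_ideal_of_mem_nonunits hunit
  have hM0 : M ≠ ⊥ := by
    rintro rfl
    exact ha0 (congrArg Subtype.val (Ideal.mem_bot.1 haM))
  exact ⟨_, placeOfPrime_ord_pos ⟨M, hM.isPrime, hM0⟩ (a := ⟨a, ha⟩) ha0 haM⟩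

end PlacesOverSubalgebra

section ZerosAndPoles

variable {K F : Type*} [Field K] [Field F] [Algebra K F] {P Q : Place K F}

theorem affineRing_le_subalgebra {x : F} (hx : x ∈ P.ring) : affineRing K x ≤ P.subalgebra := by
  rintro a ⟨f, hf, hfa⟩
  have hle : Algebra.adjoin K {x} ≤ P.subalgebra :=
    Algebra.adjoin_le (Set.singleton_subset_iff.2 hx)
  let φ : Polynomial K →+* P.ring := (Polynomial.aeval x).toRingHom.codRestrict P.ring
    fun r => hle (Polynomial.aeval_mem_adjoin_singleton K x)
  have ha : IsIntegral P.ring a := ⟨f.map φ, hf.map φ, by rw [Polynomial.eval₂_map]; exact hfa⟩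
  obtain ⟨b, rfl⟩ := IsIntegrallyClosed.isIntegral_iff.1 ha
  exact b.2

theorem D_inv_ne_zero {x : F} (hx : D K F x ≠ 0) : D K F x⁻¹ ≠ 0 := by
  have hx0 : x ≠ 0 := by
    rintro rfl
    exact hx (map_zero _)
  rw [Derivation.leibniz_inv]
  exact smul_ne_zero (neg_ne_zero.2 (pow_ne_zero _ (inv_ne_zero hx0))) hx

/-- The functions regular at `P` whose differential is a multiple of `dx` regular at `P`. -/
def Place.generatedBy (P : Place K F) (x : F) : Subalgebra K F where
  carrier := {a | a ∈ P.ring ∧ ∃ k ∈ P.ring, D K F a = k • D K F x}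
  mul_mem' := by
    rintro a b ⟨ha, k, hk, hka⟩ ⟨hb, l, hl, hlb⟩
    refine ⟨mul_mem ha hb, a * l + b * k, add_mem (mul_mem ha hl) (mul_mem hb hk), ?_⟩
    rw [Derivation.leibniz, hka, hlb, add_smul, mul_smul, mul_smul]
  add_mem' := by
    rintro a b ⟨ha, k, hk, hka⟩ ⟨hb, l, hl, hlb⟩
    exact ⟨add_mem ha hb, k + l, add_mem hk hl, by rw [map_add, hka, hlb, add_smul]⟩
  algebraMap_mem' c := ⟨P.algebraMap_mem c, 0, zero_mem _, by simp⟩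

theorem Place.self_mem_generatedBy {x : F} (hx : x ∈ P.ring) : x ∈ P.generatedBy x :=
  ⟨hx, 1, one_mem _, (one_smul _ _).symm⟩

theorem Place.mem_generatedBy_of_mul_mem {x g b : F} (hg : g ∈ P.ring) (hb : b ∈ P.generatedBy x)
    (hbP : P.val b = 1) (hgb : g * b ∈ P.generatedBy x) : g ∈ P.generatedBy x := by
  obtain ⟨-, k, hk, hka⟩ := hgb
  obtain ⟨-, l, hl, hlb⟩ := hb
  have hb0 : b ≠ 0 := by
    rintro rfl
    simp at hbP
  have hbi : b⁻¹ ∈ P.ring := by rw [← P.val_le_one_iff, map_inv₀, hbP, inv_one]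
  refine ⟨hg, b⁻¹ * (k - g * l), mul_mem hbi (sub_mem hk (mul_mem hg hl)), ?_⟩
  rw [Derivation.leibniz, hlb] at hka
  rw [mul_smul, sub_smul, mul_smul, ← hka, add_sub_cancel_left, inv_smul_smul₀ hb0]

variable [PerfectField K]

theorem IsFunctionField.finite_ord_pos (hF : IsFunctionField K F) {z : F} (hz : z ≠ 0) :
    {P : Place K F | 0 < P.ord z}.Finite := by
  obtain ⟨x, hx⟩ := hF.exists_D_ne_zero
  have hfin {y : F} (hy : D K F y ≠ 0) :
      {P : Place K F | affineRing K y ≤ P.subalgebra ∧ 0 < P.ord z}.Finite := by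
    have := hF.isDedekindDomain_affineRing hy
    have := hF.isFractionRing_affineRing hy
    exact finite_ord_pos_of_le_subalgebra hz
  refine ((hfin hx).union (hfin (D_inv_ne_zero hx))).subset fun P hP => ?_
  exact (P.ring.mem_or_inv_mem x).imp (fun h => ⟨affineRing_le_subalgebra h, hP⟩)
    fun h => ⟨affineRing_le_subalgebra h, hP⟩

theorem IsFunctionField.finite_notMem_ring (hF : IsFunctionField K F) (z : F) :
    {P : Place K F | z ∉ P.ring}.Finite := by
  rcases eq_or_ne z 0 with rfl | hz
  · exact Set.finite_empty.subset fun P hP => hP (zero_mem _)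
  refine (hF.finite_ord_pos (inv_ne_zero hz)).subset fun P hP => ?_
  rw [Set.mem_ofPred_eq, Place.mem_ring_iff hz] at hP
  rw [Set.mem_ofPred_eq, Place.ord_inv]
  omega

theorem IsFunctionField.mem_generatedBy (hF : IsFunctionField K F) {x : F} (hx : D K F x ≠ 0)
    (hA : affineRing K x ≤ P.generatedBy x) {g : F} (hg : g ∈ P.ring) : g ∈ P.generatedBy x := by
  have := hF.isDedekindDomain_affineRing hx
  have := hF.isFractionRing_affineRing hx
  obtain ⟨a, b, hb, hab⟩ := Place.exists_mul_eq (fun _ ha => (hA ha).1) hg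
  exact Place.mem_generatedBy_of_mul_mem hg (hA b.2) hb (hab ▸ hA a.2)

theorem IsFunctionField.finite_not_generates (hF : IsFunctionField K F) {x : F}
    (hx : D K F x ≠ 0) :
    {P : Place K F | ¬ ∀ g ∈ P.ring, ∃ k ∈ P.ring, D K F g = k • D K F x}.Finite := by
  obtain ⟨Y, -, hY⟩ := hF.exists_affineRing_le_span hx
  choose h hh using fun y => hF.exists_smul_D hx (D K F y)
  have hfin : (⋃ y ∈ Y, ({P : Place K F | y ∉ P.ring} ∪ {P : Place K F | h y ∉ P.ring})).Finite :=
    Y.finite_toSet.biUnion fun y _ => (hF.finite_notMem_ring y).union (hF.finite_notMem_ring (h y))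
  refine ((hF.finite_notMem_ring x).union hfin).subset fun P hP => ?_
  by_contra hgood
  simp only [Set.mem_union, Set.mem_iUnion, Set.mem_ofPred_eq, not_or, not_exists, not_not]
    at hgood
  obtain ⟨hxP, hYP⟩ := hgood
  have hA : affineRing K x ≤ P.generatedBy x := fun a ha => by
    refine Submodule.span_le (p := Subalgebra.toSubmodule (P.generatedBy x)).2 ?_ (hY ha)
    rintro _ ⟨j, -, y, hy, rfl⟩
    exact (P.generatedBy x).mul_mem (pow_mem (Place.self_mem_generatedBy hxP) j)
      ⟨(hYP y hy).1, h y, (hYP y hy).2, hh y⟩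
  exact hP fun g hg => (hF.mem_generatedBy hx hA hg).2

theorem IsFunctionField.exists_ord_pos (hF : IsFunctionField K F) {x : F} (hx : D K F x ≠ 0) :
    ∃ P : Place K F, 0 < P.ord x := by
  have := hF.isDedekindDomain_affineRing hx
  have := hF.isFractionRing_affineRing hx
  exact exists_ord_pos_of_inv_notMem (self_mem_affineRing x)
    (inv_notMem_affineRing (hF.transcendental_of_D_ne_zero hx))

variable (p : ℕ) [Fact p.Prime] [CharP F p]
include p

theorem IsFunctionField.exists_eq_pow_pow (hF : IsFunctionField K F) {f : F}
    (hf : P.ord f ≠ 0) : ∃ (g : F) (n : ℕ), f = g ^ p ^ n ∧ D K F g ≠ 0 := by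
  obtain ⟨x, hx⟩ := hF.exists_D_ne_zero
  induction hm : (P.ord f).natAbs using Nat.strong_induction_on generalizing f with
  | _ m ih =>
    by_cases hD : D K F f = 0
    · obtain ⟨g, rfl⟩ := (hF.isPGenerator p hx).eq_pow_of_D_eq_zero p hx hD
      have hp := (Fact.out : p.Prime).one_lt
      rw [Place.ord_pow] at hf hm
      have hg : P.ord g ≠ 0 := right_ne_zero_of_mul hf
      obtain ⟨h, n, rfl, hh⟩ := ih (P.ord g).natAbs (by
        rw [← hm, Int.natAbs_mul, Int.natAbs_natCast]
        exact lt_mul_left (Int.natAbs_pos.2 hg) hp) hg rfl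
      exact ⟨h, n + 1, by rw [← pow_mul, pow_succ], hh⟩
    · exact ⟨f, 0, by simp, hD⟩

theorem IsFunctionField.ord_eq_zero_of_forall_mem_ring (hF : IsFunctionField K F) {f : F}
    (hf : ∀ P : Place K F, f ∈ P.ring) (Q : Place K F) : Q.ord f = 0 := by
  by_contra hQ
  obtain ⟨g, n, rfl, hg⟩ := hF.exists_eq_pow_pow p hQ
  obtain ⟨P, hP⟩ := hF.exists_ord_pos (D_inv_ne_zero hg)
  have hord := Place.ord_nonneg (hf P)
  rw [Place.ord_pow] at hord
  rw [Place.ord_inv] at hP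
  have hpn : (0 : ℤ) < (p ^ n : ℕ) := mod_cast pow_pos (Fact.out : p.Prime).pos n
  nlinarith

end ZerosAndPoles

section SinglePole

open Polynomial

variable {K F : Type*} [Field K] [Field F] [Algebra K F]

theorem exists_aeval_mem_of_pow_mem_sup {S V : Submodule K F} [FiniteDimensional K V] {u : F}
    (hu : ∀ n, u ^ n ∈ S ⊔ V) : ∃ r : K[X], 0 < r.natDegree ∧ aeval u r ∈ S := by
  let φ : K[X] →ₗ[K] F ⧸ S := S.mkQ ∘ₗ (aeval u).toLinearMap ∘ₗ LinearMap.mulLeft K X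
  have hrange : LinearMap.range φ ≤ V.map S.mkQ := by
    rintro _ ⟨r, rfl⟩
    have hmem : aeval u (X * r) ∈ S ⊔ V := by
      rw [aeval_eq_sum_range]
      exact sum_mem fun n _ => Submodule.smul_mem _ _ (hu n)
    obtain ⟨s, hs, v, hv, hsv⟩ := Submodule.mem_sup.1 hmem
    refine ⟨v, hv, (Submodule.Quotient.eq S).2 ?_⟩
    change v - aeval u (X * r) ∈ S
    rw [← hsv, sub_add_cancel_right]
    exact neg_mem hs
  have hφ : LinearMap.ker φ ≠ ⊥ := fun hker => by
    have := Submodule.finiteDimensional_of_le hrange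
    exact Polynomial.not_finite (R := K)
      (Module.Finite.of_injective φ.rangeRestrict (by
        rwa [← LinearMap.ker_eq_bot, LinearMap.ker_rangeRestrict]))
  obtain ⟨r, hr, hr0⟩ := Submodule.exists_mem_ne_zero_of_ne_bot hφ
  exact ⟨X * r, by rw [natDegree_X_mul hr0]; exact Nat.succ_pos _,
    by simpa [φ] using hr⟩

instance (P : Place K F) : P.val.IsTrivialOn K where
  eq_one c hc := by
    refine (P.val_le_one_iff.2 (P.algebraMap_mem c)).antisymm ?_
    have hinv := P.val_le_one_iff.2 (P.algebraMap_mem c⁻¹)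
    rwa [map_inv₀, map_inv₀, inv_le_one₀] at hinv
    exact zero_lt_iff.2 ((Valuation.ne_zero_iff _).2 ((_root_.map_ne_zero _).2 hc))

variable {P Q : Place K F}

theorem Place.aeval_notMem_ring {u : F} (hu : u ∉ P.ring) {r : K[X]} (hr : 0 < r.natDegree) :
    aeval u r ∉ P.ring := by
  rw [← P.val_le_one_iff, not_le] at hu ⊢
  rw [valuation_aeval_eq_valuation_X_pow_natDegree_of_one_lt_valuation_X u hu
    (ne_zero_of_natDegree_gt hr)]
  exact one_lt_pow₀ hu hr.ne'

/-- The ring of functions regular at every pole of `x`. -/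
def regularAtPoles (x : F) : Subalgebra K F :=
  ⨅ P : {P : Place K F // x ∉ P.ring}, P.1.subalgebra

theorem mem_regularAtPoles {x z : F} :
    z ∈ regularAtPoles (K := K) x ↔ ∀ P : Place K F, x ∉ P.ring → z ∈ P.ring := by
  rw [regularAtPoles, Algebra.mem_iInf, Subtype.forall]
  rfl

theorem inv_mem_regularAtPoles (x : F) : x⁻¹ ∈ regularAtPoles (K := K) x :=
  mem_regularAtPoles.2 fun P hP => (P.ring.mem_or_inv_mem x).resolve_left hP

theorem IsFunctionField.exists_inv_pow_mul_mem_regularAtPoles [PerfectField K]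
    (hF : IsFunctionField K F) (x y : F) :
    ∃ c : ℕ, x⁻¹ ^ c * y ∈ regularAtPoles (K := K) x := by
  have hfin := hF.finite_notMem_ring x
  set c : ℕ := ∑ P ∈ hfin.toFinset, (P.ord y).natAbs
  refine ⟨c, mem_regularAtPoles.2 fun P hP => ?_⟩
  rcases eq_or_ne y 0 with hy | hy
  · rw [hy, mul_zero]
    exact zero_mem _
  have hx : x ≠ 0 := by
    rintro rfl
    exact hP (zero_mem _)
  have hord : 1 ≤ P.ord x⁻¹ := by
    rw [Place.mem_ring_iff hx] at hP
    rw [Place.ord_inv]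
    omega
  have hle : (P.ord y).natAbs ≤ c :=
    Finset.single_le_sum (f := fun P : Place K F => (P.ord y).natAbs) (fun _ _ => Nat.zero_le _)
      (hfin.mem_toFinset.2 hP)
  refine Place.mem_ring_of_ord_nonneg ?_
  rw [Place.ord_mul (pow_ne_zero _ (inv_ne_zero hx)) hy, Place.ord_pow]
  have hle' : -P.ord y ≤ c := by omega
  nlinarith

theorem zpow_mul_mem_sup_span {x y : F} (hy : y ∈ affineRing K x) {c : ℕ}
    (hc : x⁻¹ ^ c * y ∈ regularAtPoles (K := K) x) (i : ℤ) :
    x ^ i * y ∈ Subalgebra.toSubmodule (affineRing K x) ⊔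
      Subalgebra.toSubmodule (regularAtPoles x) ⊔
      Submodule.span K ((fun j : ℤ => x ^ j * y) '' Set.Ioo (-c : ℤ) 0) := by
  rcases le_or_gt 0 i with hi | hi
  · lift i to ℕ using hi
    refine Submodule.mem_sup_left (Submodule.mem_sup_left ?_)
    rw [zpow_natCast]
    exact (affineRing K x).mul_mem (pow_mem (self_mem_affineRing x) i) hy
  rcases le_or_gt i (-c) with hic | hic
  · obtain ⟨n, hn⟩ := Int.eq_ofNat_of_zero_le (sub_nonneg.2 hic)
    have hi' : x ^ i = x⁻¹ ^ n * x⁻¹ ^ c := by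
      rw [← pow_add, ← zpow_natCast, inv_zpow']
      congr 1
      omega
    refine Submodule.mem_sup_left (Submodule.mem_sup_right ?_)
    rw [hi', mul_assoc]
    exact (regularAtPoles x).mul_mem (pow_mem (inv_mem_regularAtPoles x) n) hc
  · exact Submodule.mem_sup_right (Submodule.subset_span ⟨i, ⟨hic, hi⟩, rfl⟩)

/- Finiteness of `H¹` for the covering of the curve by the complements of the poles and of the
zeros of `x`, whose intersection has coordinate ring `A[1/x]`. -/
theorem IsFunctionField.exists_finiteDimensional_sup [PerfectField K] (hF : IsFunctionField K F)
    {x : F} (hx : D K F x ≠ 0) :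
    ∃ V : Submodule K F, FiniteDimensional K V ∧ ∀ (z : F) (N : ℕ), x ^ N * z ∈ affineRing K x →
      z ∈ Subalgebra.toSubmodule (affineRing K x) ⊔
        Subalgebra.toSubmodule (regularAtPoles x) ⊔ V := by
  obtain ⟨Y, hYA, hY⟩ := hF.exists_affineRing_le_span hx
  have hx0 : x ≠ 0 := by
    rintro rfl
    exact hx (map_zero _)
  choose c hc using hF.exists_inv_pow_mul_mem_regularAtPoles (K := K) x
  let s : Set F := ⋃ y ∈ Y, (fun i : ℤ => x ^ i * y) '' Set.Ioo (-c y : ℤ) 0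
  have hs : s.Finite := Y.finite_toSet.biUnion fun y _ => (Set.finite_Ioo _ _).image _
  refine ⟨Submodule.span K s, FiniteDimensional.span_of_finite K hs, fun z N hz => ?_⟩
  set T := Subalgebra.toSubmodule (affineRing K x) ⊔
    Subalgebra.toSubmodule (regularAtPoles x) ⊔ Submodule.span K s
  have hgen (i : ℤ) {y : F} (hy : y ∈ Y) : x ^ i * y ∈ T := by
    have hsub : (fun i : ℤ => x ^ i * y) '' Set.Ioo (-c y : ℤ) 0 ⊆ s :=
      Set.subset_biUnion_of_mem (u := fun y => (x ^ · * y) '' Set.Ioo (-c y : ℤ) 0) hy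
    have hle := sup_le_sup_left (Submodule.span_mono (R := K) hsub)
      (Subalgebra.toSubmodule (affineRing K x) ⊔ Subalgebra.toSubmodule (regularAtPoles x))
    exact hle (zpow_mul_mem_sup_span (hYA hy) (hc y) i)
  have hle : Submodule.span K (Set.image2 (fun (j : ℕ) y => x ^ j * y) Set.univ Y) ≤
      T.comap (LinearMap.mulLeft K (x ^ (-N : ℤ))) := by
    rw [Submodule.span_le]
    rintro _ ⟨j, -, y, hy, rfl⟩
    change x ^ (-N : ℤ) * (x ^ j * y) ∈ T
    rw [← mul_assoc, ← zpow_natCast, ← zpow_add₀ hx0]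
    exact hgen _ hy
  have hmem : x ^ (-N : ℤ) * (x ^ N * z) ∈ T := hle (hY hz)
  rwa [zpow_neg, zpow_natCast, inv_mul_cancel_left₀ (pow_ne_zero N hx0)] at hmem

variable [Finite K] (p : ℕ) [Fact p.Prime] [CharP F p]
include p

theorem IsFunctionField.exists_pole_only_at (hF : IsFunctionField K F) (Q : Place K F) :
    ∃ g ∉ Q.ring, ∀ P : Place K F, P ≠ Q → g ∈ P.ring := by
  obtain ⟨x, hxQ⟩ := Q.exists_isUniformizer
  have hx := hF.D_ne_zero_of_isUniformizer p hxQ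
  have := hF.isDedekindDomain_affineRing hx
  have := hF.isFractionRing_affineRing hx
  have := hF.finite_classGroup_affineRing hx
  have hAQ := affineRing_le_subalgebra hxQ.mem_ring
  obtain ⟨h, hh, f, hf⟩ := Place.exists_under_pow_eq_span hAQ
  obtain ⟨hf0, hfQ⟩ := Place.ord_pos_of_under_pow_eq_span hAQ hh hf
  have hu : (f : F)⁻¹ ∉ Q.ring := fun hu => by
    have := Place.ord_nonneg hu
    rw [Place.ord_inv] at this
    omega
  obtain ⟨a, ha⟩ : f ∣ (⟨x, self_mem_affineRing x⟩ : affineRing K x) ^ h := by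
    rw [← Ideal.mem_span_singleton, ← hf]
    exact Ideal.pow_mem_pow ((Place.mem_under_iff hAQ).2 (by
      rw [hxQ, ← WithZero.exp_zero, WithZero.exp_lt_exp]
      exact neg_one_lt_zero)) h
  replace ha : x ^ h * (f : F)⁻¹ = a :=
    (mul_inv_eq_iff_eq_mul₀ hf0).2 ((congrArg Subtype.val ha).trans (mul_comm _ _))
  obtain ⟨V, _, hV⟩ := hF.exists_finiteDimensional_sup hx
  obtain ⟨r, hr, hmem⟩ := exists_aeval_mem_of_pow_mem_sup fun n =>
    hV ((f : F)⁻¹ ^ n) (h * n) (by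
      rw [pow_mul, ← mul_pow, ha]
      exact pow_mem a.2 n)
  obtain ⟨a, ha, b, hb, hab⟩ := Submodule.mem_sup.1 hmem
  refine ⟨b, fun hbQ => Place.aeval_notMem_ring hu hr (hab ▸ add_mem (hAQ ha) hbQ),
    fun P hPQ => ?_⟩
  by_cases hxP : x ∈ P.ring
  · have hAP := affineRing_le_subalgebra hxP
    have huP : (f : F)⁻¹ ∈ P.ring := Place.mem_ring_of_ord_nonneg (by
      rw [Place.ord_inv, Place.ord_eq_zero_of_under_pow_eq_span hAQ hf hAP hPQ.symm, neg_zero])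
    have hrP : aeval (f : F)⁻¹ r ∈ P.subalgebra :=
      Algebra.adjoin_le (Set.singleton_subset_iff.2 huP) (aeval_mem_adjoin_singleton K _)
    exact eq_sub_of_add_eq' hab ▸ sub_mem hrP (hAP ha)
  · exact mem_regularAtPoles.1 hb P hxP

/- If `dy = 0` then `y` is a `p`-th power, so a pole only at `Q` with nonzero differential is
obtained by extracting `p`-th roots. -/
theorem IsFunctionField.exists_D_ne_zero_pole_only_at (hF : IsFunctionField K F) (Q : Place K F) :
    ∃ y : F, D K F y ≠ 0 ∧ y ∉ Q.ring ∧ ∀ P : Place K F, P ≠ Q → y ∈ P.ring := by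
  obtain ⟨g, hgQ, hg⟩ := hF.exists_pole_only_at p Q
  obtain ⟨y, n, rfl, hy⟩ := hF.exists_eq_pow_pow p (P := Q) (f := g) fun h =>
    hgQ (Place.mem_ring_of_ord_nonneg h.ge)
  refine ⟨y, hy, fun h => hgQ (pow_mem h _), fun P hP => Place.mem_ring_of_ord_nonneg ?_⟩
  have hord := Place.ord_nonneg (hg P hP)
  rw [Place.ord_pow] at hord
  exact nonneg_of_mul_nonneg_right hord (mod_cast pow_pos (Fact.out : p.Prime).pos n)

end SinglePole

section Units

theorem exists_forall_dvd_of_map_sum_eq {M ι κ : Type*} [AddCommGroup M] [Finite ι] [Finite κ]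
    (φ : M →ₗ[ℤ] κ → ℤ) {v : ι → M} (hv : LinearIndependent ℤ fun i => φ (v i)) :
    ∃ f : ι → M, ∀ (s : Finset ι) (m : ι → ℤ) (c : ℤ) (w : M),
      φ (∑ i ∈ s, m i • f i) = c • φ w → ∀ i ∈ s, c ∣ m i := by
  have := Fintype.ofFinite ι
  let b := Module.finBasis ℤ (LinearMap.range φ)
  have hli : LinearIndependent ℤ fun i => φ.rangeRestrict (v i) :=
    LinearIndependent.of_comp (LinearMap.range φ).subtype hv
  let a : ι ↪ Fin (Module.finrank ℤ (LinearMap.range φ)) :=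
    (Function.Embedding.nonempty_of_card_le
      (by simpa using hli.fintype_card_le_finrank)).some
  choose f hf using fun i => φ.surjective_rangeRestrict (b (a i))
  refine ⟨f, fun s m c w h i hi => ?_⟩
  have hrange : ∑ j ∈ s, m j • b (a j) = c • φ.rangeRestrict w := by
    simp only [← hf, ← map_zsmul, ← map_sum]
    exact Subtype.ext (by simpa using h)
  have hcoord := congrArg (b.coord (a i)) hrange
  rw [map_sum, Finset.sum_eq_single_of_mem i hi fun j _ hj => by
    simp [hj]] at hcoord
  exact ⟨b.coord (a i) (φ.rangeRestrict w), by simpa using hcoord⟩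

variable {K F : Type*} [Field K] [Field F] [Algebra K F]

/-- The order at a place as a homomorphism on the group `Fˣ`, written additively. -/
noncomputable def Place.ordHom (P : Place K F) : Additive Fˣ →+ ℤ where
  toFun f := P.ord (f.toMul : F)
  map_zero' := by simpa using P.ord_pow 1 0
  map_add' f g := by simpa using P.ord_mul f.toMul.ne_zero g.toMul.ne_zero

/-- The group of the functions without zeros and poles outside the set of places `E`, written
additively. -/
noncomputable def unitsOutside (E : Set (Place K F)) : AddSubgroup (Additive Fˣ) :=
  ⨅ Q ∉ E, Q.ordHom.ker

theorem mem_unitsOutside {E : Set (Place K F)} {f : Additive Fˣ} :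
    f ∈ unitsOutside E ↔ ∀ Q ∉ E, Q.ordHom f = 0 := by
  simp [unitsOutside, AddSubgroup.mem_iInf, AddMonoidHom.mem_ker]

theorem mem_unitsOutside_of_nsmul_mem {E : Set (Place K F)} {n : ℕ} (hn : n ≠ 0)
    {f : Additive Fˣ} (hf : n • f ∈ unitsOutside E) : f ∈ unitsOutside E := by
  refine mem_unitsOutside.2 fun Q hQ => ?_
  have hQ := mem_unitsOutside.1 hf Q hQ
  rw [map_nsmul] at hQ
  exact (smul_eq_zero.1 hQ).resolve_left hn

theorem IsFunctionField.exists_ord_pos_only_at [Finite K] (hF : IsFunctionField K F) {x : F}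
    (hx : D K F x ≠ 0) {Q : Place K F} (hQ : x ∈ Q.ring) :
    ∃ f : F, f ≠ 0 ∧ 0 < Q.ord f ∧
      ∀ P : Place K F, x ∈ P.ring → P ≠ Q → P.ord f = 0 := by
  have := hF.isDedekindDomain_affineRing hx
  have := hF.isFractionRing_affineRing hx
  have := hF.finite_classGroup_affineRing hx
  have hAQ := affineRing_le_subalgebra hQ
  obtain ⟨h, hh, f, hf⟩ := Place.exists_under_pow_eq_span hAQ
  obtain ⟨hf0, hfQ⟩ := Place.ord_pos_of_under_pow_eq_span hAQ hh hf
  exact ⟨f, hf0, hfQ, fun P hP hPQ =>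
    Place.ord_eq_zero_of_under_pow_eq_span hAQ hf (affineRing_le_subalgebra hP) hPQ.symm⟩

variable (p : ℕ) [Fact p.Prime] [CharP F p] [Finite K]
include p

theorem IsFunctionField.exists_diagonal_units (hF : IsFunctionField K F) (Q : Place K F)
    (I : Finset (Place K F)) (hQ : Q ∉ I) :
    ∃ v : I → unitsOutside (insert Q (I : Set (Place K F))), ∀ i : I, 0 < i.1.ordHom (v i) ∧
      ∀ j : I, j ≠ i → j.1.ordHom (v i) = 0 := by
  obtain ⟨y, hy, -, hreg⟩ := hF.exists_D_ne_zero_pole_only_at p Q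
  have hne (i : I) : i.1 ≠ Q := fun h => hQ (h ▸ i.2)
  choose f hf0 hfpos hf using fun i : I => hF.exists_ord_pos_only_at hy (hreg i (hne i))
  refine ⟨fun i => ⟨.ofMul (.mk0 (f i) (hf0 i)), mem_unitsOutside.2 fun P hP => ?_⟩,
    fun i => ⟨hfpos i, fun j hj => hf i j (hreg j (hne j)) (Subtype.coe_ne_coe.2 hj)⟩⟩
  rw [Set.mem_insert_iff, not_or] at hP
  exact hf i P (hreg P hP.1) fun h => hP.2 (h ▸ i.2)

theorem IsFunctionField.exists_linearIndependent_dlog_of_map (hF : IsFunctionField K F)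
    {E : Set (Place K F)} {ι κ : Type*} [Finite ι] [Finite κ]
    (φ : unitsOutside E →ₗ[ℤ] κ → ℤ) {v : ι → unitsOutside E}
    (hv : LinearIndependent ℤ fun i => φ (v i)) :
    ∃ f : ι → unitsOutside E, LinearIndependent K fun i => dlog K F (f i) := by
  have hp : p ≠ 0 := (Fact.out : p.Prime).ne_zero
  obtain ⟨f, hf⟩ := exists_forall_dvd_of_map_sum_eq φ hv
  refine ⟨f, hF.linearIndependent_dlog (p := p) (f := fun i => (f i).1.toMul) fun s m g hg => ?_⟩
  have hg0 : g ≠ 0 := by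
    rintro rfl
    rw [zero_pow hp] at hg
    exact Units.ne_zero _ hg
  have hpow : (∑ i ∈ s, m i • f i : unitsOutside E).1 = p • Additive.ofMul (Units.mk0 g hg0) := by
    apply Additive.toMul.injective
    ext
    simpa using hg
  have hgE : Additive.ofMul (Units.mk0 g hg0) ∈ unitsOutside E :=
    mem_unitsOutside_of_nsmul_mem hp (hpow ▸ (∑ i ∈ s, m i • f i : unitsOutside E).2)
  refine hf s m p ⟨_, hgE⟩ ?_
  rw [← map_zsmul]
  congr 1
  exact Subtype.ext (by simpa using hpow)

theorem IsFunctionField.exists_linearIndependent_dlog (hF : IsFunctionField K F) (Q : Place K F)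
    (I : Finset (Place K F)) (hQ : Q ∉ I) :
    ∃ f : I → unitsOutside (insert Q (I : Set (Place K F))),
      LinearIndependent K fun i => dlog K F (f i) := by
  obtain ⟨v, hv⟩ := hF.exists_diagonal_units p Q I hQ
  refine hF.exists_linearIndependent_dlog_of_map (p := p)
    (LinearMap.pi fun i : I => (i.1.ordHom.comp (AddSubgroup.subtype _)).toIntLinearMap) (v := v) ?_
  rw [Fintype.linearIndependent_iff]
  intro c hc i
  have hci := congrFun hc i
  rw [Finset.sum_apply, Finset.sum_eq_single_of_mem i (Finset.mem_univ i) fun j _ hj =>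
    by simp [(hv j).2 i hj.symm]] at hci
  exact (mul_eq_zero.1 hci).resolve_right (hv i).1.ne'

end Units

section ResidueFields

variable {K F : Type*} [Field K] [Field F] [Algebra K F]

/-- The reduction map from the local ring at a place to the residue field, as a map of
`K`-algebras. -/
noncomputable def Place.residue (P : Place K F) :
    P.subalgebra →ₐ[K] IsLocalRing.ResidueField P.ring :=
  { (IsLocalRing.residue P.ring).comp
      (P.subalgebra.toSubring.subtype.codRestrict P.ring fun a => a.2) with
    commutes' := fun _ => rfl }

variable {P : Place K F}

theorem Place.residue_surjective : Function.Surjective P.residue :=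
  IsLocalRing.residue_surjective (R := P.ring)

theorem Place.residue_eq_zero_iff {z : P.subalgebra} : P.residue z = 0 ↔ P.val z < 1 :=
  (IsLocalRing.residue_eq_zero_iff (R := P.ring) z).trans
    ((IsDiscreteValuationRing.maximalIdeal P.ring).valuation_lt_one_iff_mem (K := F) z).symm

/- The coordinate ring `A` of functions regular where the uniformizer `t` is regular is a finitely
generated `K[t]`-module and `t` vanishes at `P`, so the image of `A` in the residue field is finite
dimensional, hence a field. -/
theorem IsFunctionField.finite_residueField (p : ℕ) [Fact p.Prime] [CharP F p] [PerfectField K]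
    (hF : IsFunctionField K F) (P : Place K F) :
    Module.Finite K (IsLocalRing.ResidueField P.ring) := by
  obtain ⟨t, ht⟩ := P.exists_isUniformizer
  have hDt := hF.D_ne_zero_of_isUniformizer p ht
  have := hF.isDedekindDomain_affineRing hDt
  have := hF.isFractionRing_affineRing hDt
  have hA := affineRing_le_subalgebra ht.mem_ring
  obtain ⟨Y, hYA, hY⟩ := hF.exists_affineRing_le_span hDt
  let ρ := P.residue.comp (Subalgebra.inclusion hA)
  let W := Submodule.span K (Set.range fun y : Y => ρ ⟨y, hYA y.2⟩)
  have hAW : Subalgebra.toSubmodule (affineRing K t) ≤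
      (W.comap P.residue.toLinearMap).map P.subalgebra.val.toLinearMap := by
    refine hY.trans (Submodule.span_le.2 ?_)
    rintro _ ⟨j, -, y, hy, rfl⟩
    refine ⟨⟨t, ht.mem_ring⟩ ^ j * ⟨y, hA (hYA hy)⟩, ?_, rfl⟩
    have ht0 : P.residue ⟨t, ht.mem_ring⟩ = 0 := Place.residue_eq_zero_iff.2
      (ht.trans_lt (WithZero.exp_lt_exp.2 neg_one_lt_zero))
    rcases eq_or_ne j 0 with rfl | hj
    · exact Submodule.subset_span ⟨⟨y, hy⟩, by simp [ρ, Subalgebra.inclusion_mk]⟩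
    · simp [ht0, hj]
  have hρ : FiniteDimensional K ρ.range := by
    have : FiniteDimensional K W := FiniteDimensional.span_of_finite K (Set.finite_range _)
    refine Submodule.finiteDimensional_of_le (S₁ := Subalgebra.toSubmodule ρ.range) (S₂ := W) ?_
    rintro _ ⟨a, rfl⟩
    obtain ⟨z, hz, hza⟩ := hAW a.2
    rwa [show z = Subalgebra.inclusion hA a from Subtype.ext hza] at hz
  refine Module.Finite.of_surjective ρ.range.val.toLinearMap fun z => ?_
  obtain ⟨⟨g, hg⟩, rfl⟩ := P.residue_surjective z
  obtain ⟨a, b, hb, hab⟩ := Place.exists_mul_eq hA hg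
  have hb0 : ρ b ≠ 0 := fun h => (Place.residue_eq_zero_iff.1 h).ne hb
  have hinv : (ρ b)⁻¹ ∈ ρ.range := ρ.range.inv_mem_of_algebraic (x := ⟨ρ b, b, rfl⟩)
    ((Algebra.IsAlgebraic.isAlgebraic (R := K) (⟨ρ b, b, rfl⟩ : ρ.range)).algebraMap)
  have hgb : P.residue ⟨g, hg⟩ * ρ b = ρ a := by
    rw [AlgHom.comp_apply, AlgHom.comp_apply, ← map_mul]
    exact congrArg P.residue (Subtype.ext hab)
  refine ⟨⟨_, mul_mem (ρ.mem_range_self a) hinv⟩, ?_⟩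
  exact ((eq_mul_inv_iff_mul_eq₀ hb0).2 hgb).symm

end ResidueFields

section Omega

variable {K F : Type*} [Field K] [Field F] [Algebra K F] {P : Place K F}

theorem Place.OrdGE.mono {ω : Ω[F⁄K]} {m n : ℤ} (h : P.OrdGE ω n) (hmn : m ≤ n) : P.OrdGE ω m := by
  intro t ht
  obtain ⟨f, hf, hv⟩ := h t ht
  exact ⟨f, hf, hv.trans (WithZero.exp_le_exp.2 (neg_le_neg hmn))⟩

theorem Omega_antitone : Antitone (Omega : Divisor K F → Submodule K Ω[F⁄K]) :=
  fun _ _ h _ hω P => (hω P).mono (h P)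

theorem Place.IsUniformizer.val_zpow_neg_mul_le_one_iff {t : F} (ht : P.IsUniformizer t) {f : F}
    {m : ℤ} : P.val (t ^ (-m) * f) ≤ 1 ↔ P.val f ≤ WithZero.exp (-m) := by
  rcases eq_or_ne f 0 with rfl | hf
  · simp
  have ht0 := zpow_ne_zero (-m) ht.ne_zero
  rw [P.val_le_one_iff, Place.mem_ring_iff (mul_ne_zero ht0 hf), Place.val_le_exp_iff hf,
    Place.ord_mul ht0 hf, Place.ord_zpow, Place.isUniformizer_iff.1 ht]
  omega

theorem Place.IsUniformizer.val_zpow_neg_mul_lt_one_iff {t : F} (ht : P.IsUniformizer t) {f : F}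
    {m : ℤ} : P.val (t ^ (-m) * f) < 1 ↔ P.val f ≤ WithZero.exp (-(m + 1)) := by
  rcases eq_or_ne f 0 with rfl | hf
  · simp
  have ht0 := zpow_ne_zero (-m) ht.ne_zero
  rw [Place.val_eq_exp (mul_ne_zero ht0 hf), ← WithZero.exp_zero, WithZero.exp_lt_exp,
    Place.val_le_exp_iff hf, Place.ord_mul ht0 hf, Place.ord_zpow, Place.isUniformizer_iff.1 ht]
  omega

variable (p : ℕ) [Fact p.Prime] [CharP F p] [PerfectField K]
include p

theorem IsFunctionField.ordGE_smul_D_iff (hF : IsFunctionField K F) {t : F}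
    (ht : P.IsUniformizer t) {f : F} {m : ℤ} :
    P.OrdGE (f • D K F t) m ↔ P.val f ≤ WithZero.exp (-m) := by
  constructor
  · intro h
    obtain ⟨g, hg, hgm⟩ := h t ht
    rwa [smul_left_injective F (hF.D_ne_zero_of_isUniformizer p ht) hg]
  · intro hf s hs
    obtain ⟨k, hk, hD⟩ := hF.exists_D_eq_smul p hs ht.mem_ring
    refine ⟨f * k, by rw [hD, smul_smul], ?_⟩
    rw [map_mul]
    exact mul_le_of_le_of_le_one hf (P.val_le_one_iff.2 hk)

theorem IsFunctionField.exists_forall_le_ord_add (hF : IsFunctionField K F) {x : F}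
    (hx : D K F x ≠ 0) (P : Place K F) :
    ∃ n : ℤ, ∀ (f : F) (m : ℤ), f ≠ 0 → P.OrdGE (f • D K F x) m → m ≤ P.ord f + n := by
  obtain ⟨t, ht⟩ := P.exists_isUniformizer
  obtain ⟨h, hh⟩ := hF.exists_smul_D (hF.D_ne_zero_of_isUniformizer p ht) (D K F x)
  have hh0 : h ≠ 0 := by
    rintro rfl
    exact hx (by rw [hh, zero_smul])
  refine ⟨P.ord h, fun f m hf hm => ?_⟩
  rwa [hh, smul_smul, hF.ordGE_smul_D_iff p ht, Place.val_le_exp_iff (mul_ne_zero hf hh0),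
    Place.ord_mul hf hh0] at hm

theorem IsFunctionField.le_ord_of_generates (hF : IsFunctionField K F) {x : F}
    (hP : ∀ g ∈ P.ring, ∃ k ∈ P.ring, D K F g = k • D K F x)
    {f : F} (hf : f ≠ 0) {m : ℤ} (hm : P.OrdGE (f • D K F x) m) : m ≤ P.ord f := by
  obtain ⟨t, ht⟩ := P.exists_isUniformizer
  have hDt := hF.D_ne_zero_of_isUniformizer p ht
  obtain ⟨k, hk, hkt⟩ := hP t ht.mem_ring
  have hk0 : k ≠ 0 := by
    rintro rfl
    exact hDt (by rw [hkt, zero_smul])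
  have hfx : f • D K F x = (f * k⁻¹) • D K F t := by
    rw [hkt, smul_smul, mul_assoc, inv_mul_cancel₀ hk0, mul_one]
  rw [hfx, hF.ordGE_smul_D_iff p ht, Place.val_le_exp_iff (mul_ne_zero hf (inv_ne_zero hk0)),
    Place.ord_mul hf (inv_ne_zero hk0), Place.ord_inv] at hm
  linarith [Place.ord_nonneg hk]

theorem IsFunctionField.exists_divisor_le_ord_add (hF : IsFunctionField K F) {x : F}
    (hx : D K F x ≠ 0) : ∃ B : Divisor K F, ∀ (P : Place K F) (f : F) (m : ℤ), f ≠ 0 →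
      P.OrdGE (f • D K F x) m → m ≤ P.ord f + B P := by
  classical
  choose n hn using hF.exists_forall_le_ord_add p hx
  have hfin := hF.finite_not_generates hx
  refine ⟨Finsupp.onFinset hfin.toFinset (fun P => if P ∈ hfin.toFinset then n P else 0)
    fun P hP => of_not_not fun h => hP (if_neg h), fun P f m hf hm => ?_⟩
  rw [Finsupp.onFinset_apply]
  split_ifs with h
  · exact hn P f m hf hm
  · rw [add_zero]
    exact hF.le_ord_of_generates p (by simpa using h) hf hm

theorem IsFunctionField.exists_Omega_eq_bot (hF : IsFunctionField K F) :
    ∃ B : Divisor K F, Omega B = ⊥ := by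
  obtain ⟨x, hx⟩ := hF.exists_D_ne_zero
  obtain ⟨Q, -⟩ := hF.exists_ord_pos hx
  obtain ⟨B, hB⟩ := hF.exists_divisor_le_ord_add p hx
  refine ⟨B + Finsupp.single Q 1, (Submodule.eq_bot_iff _).2 fun ω hω => ?_⟩
  obtain ⟨f, rfl⟩ := hF.exists_smul_D hx ω
  by_contra hne
  have hf : f ≠ 0 := fun h => hne (by rw [h, zero_smul])
  have hord (P : Place K F) : Finsupp.single Q 1 P ≤ P.ord f := by
    have := hB P f _ hf (hω P)
    rw [Finsupp.add_apply] at this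
    omega
  have hreg (P : Place K F) : f ∈ P.ring :=
    Place.mem_ring_of_ord_nonneg ((Finsupp.single_nonneg.2 zero_le_one P).trans (hord P))
  have hQ := hord Q
  rw [Finsupp.single_eq_same, hF.ord_eq_zero_of_forall_mem_ring p hreg] at hQ
  omega

theorem IsFunctionField.rank_Omega_le_add_degree (hF : IsFunctionField K F) (A : Divisor K F)
    (P : Place K F) :
    Module.rank K (Omega A) ≤ Module.rank K (Omega (A + Finsupp.single P 1)) + P.degree := by
  obtain ⟨t, ht⟩ := P.exists_isUniformizer
  have hDt := hF.D_ne_zero_of_isUniformizer p ht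
  let c : F ≃ₗ[K] Ω[F⁄K] := (LinearEquiv.ofBijective (LinearMap.toSpanSingleton F _ (D K F t))
    ⟨smul_left_injective F hDt, fun ω => (hF.exists_smul_D hDt ω).imp fun _ h => h.symm⟩)
    |>.restrictScalars K
  have hc {ω : Ω[F⁄K]} {m : ℤ} : P.OrdGE ω m ↔ P.val (c.symm ω) ≤ WithZero.exp (-m) := by
    rw [← hF.ordGE_smul_D_iff p ht]
    exact (congrArg (P.OrdGE · m) (c.apply_symm_apply ω)).to_iff.symm
  let z : Omega A →ₗ[K] P.subalgebra :=
    (LinearMap.mulLeft K (t ^ (-A P)) ∘ₗ c.symm.toLinearMap ∘ₗ (Omega A).subtype).codRestrict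
      (Subalgebra.toSubmodule P.subalgebra) fun ω => P.val_le_one_iff.1
        (ht.val_zpow_neg_mul_le_one_iff.2 (hc.1 (ω.2 P)))
  let T := P.residue.toLinearMap ∘ₗ z
  have hker : (LinearMap.ker T).map (Omega A).subtype ≤ Omega (A + Finsupp.single P 1) := by
    rintro _ ⟨ω, hω, rfl⟩ Q
    rcases eq_or_ne Q P with rfl | hQP
    · rw [Finsupp.add_apply, Finsupp.single_eq_same]
      exact hc.2 (ht.val_zpow_neg_mul_lt_one_iff.1 (Place.residue_eq_zero_iff.1 hω))
    · rw [Finsupp.add_apply, Finsupp.single_eq_of_ne hQP, add_zero]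
      exact ω.2 Q
  rw [← LinearMap.rank_range_add_rank_ker T, add_comm,
    (Submodule.equivMapOfInjective (Omega A).subtype Subtype.val_injective _).rank_eq]
  gcongr
  · exact Submodule.rank_mono hker
  · have := hF.finite_residueField p P
    rw [Place.degree, Module.finrank_eq_rank]
    exact Submodule.rank_le _

end Omega

section Degree

variable {K F : Type*} [Field K] [Field F] [Algebra K F]

theorem Divisor.deg_add (A B : Divisor K F) : (A + B).deg = A.deg + B.deg :=
  Finsupp.sum_add_index' (fun _ => zero_mul _) fun _ _ _ => add_mul _ _ _

theorem Divisor.deg_single (P : Place K F) (m : ℤ) :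
    Divisor.deg (Finsupp.single P m) = m * P.degree :=
  Finsupp.sum_single_index (zero_mul _)

theorem Divisor.deg_nonneg {A : Divisor K F} (hA : 0 ≤ A) : 0 ≤ A.deg :=
  Finset.sum_nonneg fun P _ => mul_nonneg (hA P) P.degree.cast_nonneg

variable (p : ℕ) [Fact p.Prime] [CharP F p] [PerfectField K]
include p

theorem IsFunctionField.rank_Omega_le_add_nat_mul_degree (hF : IsFunctionField K F)
    (A : Divisor K F) (P : Place K F) (m : ℕ) :
    Module.rank K (Omega A) ≤
      Module.rank K (Omega (A + Finsupp.single P (m : ℤ))) + (m * P.degree : ℕ) := by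
  induction m with
  | zero =>
    rw [Nat.cast_zero, Finsupp.single_zero, add_zero]
    exact self_le_add_right _ _
  | succ m ih =>
    refine (ih.trans (add_le_add_left (hF.rank_Omega_le_add_degree p _ P) _)).trans_eq ?_
    rw [add_assoc A, ← Finsupp.single_add, add_assoc, add_one_mul]
    push_cast
    rw [add_comm (P.degree : Cardinal)]

theorem IsFunctionField.rank_Omega_le_add_deg (hF : IsFunctionField K F) {C : Divisor K F}
    (hC : 0 ≤ C) (A : Divisor K F) :
    Module.rank K (Omega A) ≤ Module.rank K (Omega (A + C)) + C.deg.toNat := by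
  induction C using Finsupp.induction generalizing A with
  | zero =>
    rw [add_zero]
    exact self_le_add_right _ _
  | single_add P m C hP _ ih =>
    classical
    have hCP : C P = 0 := Finsupp.notMem_support_iff.1 hP
    have hm : 0 ≤ m := by simpa [hCP] using hC P
    have hC' : 0 ≤ C := fun Q => by
      rcases eq_or_ne Q P with rfl | hQ
      · exact hCP.ge
      · simpa [Finsupp.single_eq_of_ne hQ] using hC Q
    lift m to ℕ using hm
    rw [Divisor.deg_add, Divisor.deg_single, Int.toNat_add (by positivity) (Divisor.deg_nonneg hC'),
      ← Nat.cast_mul, Int.toNat_natCast, ← add_assoc A, Nat.cast_add,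
      add_comm (_ : Cardinal) (Divisor.deg C).toNat, ← add_assoc]
    exact (hF.rank_Omega_le_add_nat_mul_degree p A P m).trans (add_le_add_left (ih hC' _) _)

theorem IsFunctionField.finite_Omega (hF : IsFunctionField K F) (A : Divisor K F) :
    Module.Finite K (Omega A) := by
  obtain ⟨B, hB⟩ := hF.exists_Omega_eq_bot p
  have hbot : Omega (A + (B - A) ⊔ 0) = ⊥ :=
    eq_bot_iff.2 (hB ▸ Omega_antitone (sub_le_iff_le_add'.1 le_sup_left))
  have h := hF.rank_Omega_le_add_deg p (C := (B - A) ⊔ 0) le_sup_right A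
  rw [hbot, rank_bot, zero_add] at h
  exact Module.rank_lt_aleph0_iff.1 (h.trans_lt Cardinal.natCast_lt_aleph0)

theorem IsFunctionField.h1_le_h1_add_deg (hF : IsFunctionField K F) {C : Divisor K F}
    (hC : 0 ≤ C) (A : Divisor K F) : (h1 A : ℤ) ≤ h1 (A + C) + C.deg := by
  have := hF.finite_Omega p A
  have := hF.finite_Omega p (A + C)
  have h := hF.rank_Omega_le_add_deg p hC A
  rw [← Module.finrank_eq_rank, ← Module.finrank_eq_rank, ← Nat.cast_add, Nat.cast_le] at h
  have hdeg := Divisor.deg_nonneg hC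
  rw [h1, h1]
  omega

end Degree

section Finrank

open Module

theorem finrank_eq_of_card_eq_pow {k K : Type*} [Field k] [Field K] [Algebra k K] [Finite K]
    {m : ℕ} (h : Nat.card K = Nat.card k ^ m) : finrank k K = m := by
  have : Finite k := .of_injective _ (algebraMap k K).injective
  exact Nat.pow_right_injective Finite.one_lt_card
    (natCard_eq_pow_finrank.symm.trans h)

variable {k E V W : Type*} [Field k] [AddCommGroup E] [Module k E] [Module.Finite k E]
  [AddCommGroup V] [Module k V] [AddCommGroup W] [Module k W]

theorem finrank_le_finrank_map_add_finrank_inf_ker (ρ : E →ₗ[k] W) (H : Submodule k E) :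
    finrank k H ≤ finrank k (H.map ρ) + finrank k (H ⊓ LinearMap.ker ρ : Submodule k E) := by
  have h := (ρ.domRestrict H).finrank_range_add_finrank_ker
  rw [LinearMap.range_domRestrict, LinearMap.ker_domRestrict,
    ← Submodule.finrank_map_subtype_eq, Submodule.map_comap_subtype] at h
  exact h.ge

theorem finrank_add_finrank_le_finrank_comap_add (φ : E →ₗ[k] V) {A B : Submodule k V}
    [Module.Finite k B] (hφ : LinearMap.range φ ≤ B) (hAB : A ≤ B) :
    finrank k E + finrank k A ≤ finrank k (A.comap φ) + finrank k B := by
  have hE := (A.mkQ ∘ₗ φ).finrank_range_add_finrank_ker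
  have hB := (A.mkQ.domRestrict B).finrank_range_add_finrank_ker
  rw [LinearMap.ker_comp, Submodule.ker_mkQ, LinearMap.range_comp] at hE
  rw [LinearMap.range_domRestrict, LinearMap.ker_domRestrict, Submodule.ker_mkQ,
    (Submodule.comapSubtypeEquivOfLe hAB).finrank_eq] at hB
  have : Module.Finite k (B.map A.mkQ) := inferInstance
  have := Submodule.finrank_mono (Submodule.map_mono (f := A.mkQ) hφ)
  omega

end Finrank

section RestrictionOfScalars

open Module

variable {k K V ι : Type*} [Field k] [Field K] [Algebra k K] [AddCommGroup V] [Module k V]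
  [Module K V] [IsScalarTower k K V] [Fintype ι] {v : ι → V}

theorem linearCombination_eq_linearCombination_algebraMap (v : ι → V) (c : ι → k) :
    Fintype.linearCombination k v c = Fintype.linearCombination K v (algebraMap k K ∘ c) := by
  simp [Fintype.linearCombination_apply]

theorem linearIndependent_linearCombination (hv : LinearIndependent K v) {κ : Type*}
    {c : κ → ι → k} (hc : LinearIndependent k c) :
    LinearIndependent K fun i => Fintype.linearCombination k v (c i) := by
  rw [funext fun i => linearCombination_eq_linearCombination_algebraMap (K := K) v (c i)]
  have hcK : LinearIndependent K fun i => algebraMap k K ∘ c i :=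
    linearIndependent_algebraMap_comp_iff.2 hc
  have hker : LinearMap.ker (Fintype.linearCombination K v) = ⊥ :=
    LinearMap.ker_eq_bot.2 hv.fintypeLinearCombination_injective
  exact hcK.map' _ hker

theorem finrank_comap_linearCombination_le (hv : LinearIndependent K v) (A : Submodule K V)
    [Module.Finite K A] :
    finrank k ((A.restrictScalars k).comap (Fintype.linearCombination k v)) ≤ finrank K A := by
  set N := (A.restrictScalars k).comap (Fintype.linearCombination k v)
  let b := finBasis k N
  have hb : LinearIndependent k fun i => (b i : ι → k) :=
    b.linearIndependent.map' N.subtype N.ker_subtype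
  let w (i : Fin (finrank k N)) : A := ⟨Fintype.linearCombination k v (b i), (b i).2⟩
  have hw : LinearIndependent K w :=
    .of_comp A.subtype (linearIndependent_linearCombination hv hb)
  simpa only [Fintype.card_fin] using hw.fintype_card_le_finrank

theorem finrank_add_mul_le_finrank_comap_add_mul {E : Type*} [AddCommGroup E] [Module k E]
    [Module.Finite k E] [Module.Finite k K] (φ : E →ₗ[k] V) {A B : Submodule K V}
    [Module.Finite K B] (hφ : LinearMap.range φ ≤ B.restrictScalars k) (hAB : A ≤ B) :
    finrank k E + finrank k K * finrank K A ≤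
      finrank k ((A.restrictScalars k).comap φ) + finrank k K * finrank K B := by
  have hB : Module.Finite k B := .trans K B
  have : Module.Finite k (B.restrictScalars k) := hB
  have h := finrank_add_finrank_le_finrank_comap_add (A := A.restrictScalars k) φ hφ hAB
  rwa [finrank_mul_finrank k K A, finrank_mul_finrank k K B]

end RestrictionOfScalars

section SimplePoles

variable {K F : Type*} [Field K] [Field F] [Algebra K F] {P : Place K F}

/-- `ω` has at most a simple pole at `P`, and its polar part has the constant coefficient `c`, the
residue of `ω` at `P`. -/
def Place.HasSimpleResidue (P : Place K F) (ω : Ω[F⁄K]) (c : K) : Prop :=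
  ∀ t : F, P.IsUniformizer t → ∃ g ∈ P.ring, ω = (algebraMap K F c * t⁻¹ + g) • D K F t

theorem Place.HasSimpleResidue.hasResidue {ω : Ω[F⁄K]} {c : K} (h : P.HasSimpleResidue ω c) :
    P.HasResidue ω c := by
  intro t ht
  obtain ⟨g, hg, hω⟩ := h t ht
  exact ⟨_, hω, 0, fun _ => c, rfl, by simpa using hg⟩

theorem Place.HasSimpleResidue.ordGE_neg_one {ω : Ω[F⁄K]} {c : K} (h : P.HasSimpleResidue ω c) :
    P.OrdGE ω (-1) := by
  intro t ht
  obtain ⟨g, hg, hω⟩ := h t ht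
  refine ⟨_, hω, ht.val_zpow_neg_mul_le_one_iff.1 (P.val_le_one_iff.2 ?_)⟩
  rw [neg_neg, zpow_one, mul_add, mul_left_comm, mul_inv_cancel₀ ht.ne_zero, mul_one]
  exact add_mem (P.algebraMap_mem c) (mul_mem ht.mem_ring hg)

theorem Place.HasSimpleResidue.ordGE_zero {ω : Ω[F⁄K]} (h : P.HasSimpleResidue ω 0) :
    P.OrdGE ω 0 := by
  intro t ht
  obtain ⟨g, hg, hω⟩ := h t ht
  rw [map_zero, zero_mul, zero_add] at hω
  exact ⟨g, hω, by simpa using P.val_le_one_iff.2 hg⟩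

theorem Place.HasSimpleResidue.linearCombination {ι : Type*} [Fintype ι] {ω : ι → Ω[F⁄K]}
    {r : ι → K} (h : ∀ i, P.HasSimpleResidue (ω i) (r i)) (c : ι → K) :
    P.HasSimpleResidue (Fintype.linearCombination K ω c) (∑ i, c i * r i) := by
  intro t ht
  choose g hg hω using fun i => h i t ht
  refine ⟨∑ i, algebraMap K F (c i) * g i,
    sum_mem fun i _ => mul_mem (P.algebraMap_mem _) (hg i), ?_⟩
  simp only [Fintype.linearCombination_apply, hω, map_sum, map_mul, Finset.sum_mul,
    ← Finset.sum_add_distrib, Finset.sum_smul, mul_assoc, ← mul_add, mul_smul, algebraMap_smul]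

theorem IsFunctionField.hasSimpleResidue_dlog (p : ℕ) [Fact p.Prime] [CharP F p] [PerfectField K]
    (hF : IsFunctionField K F) (P : Place K F) (f : Additive Fˣ) :
    P.HasSimpleResidue (dlog K F f) (P.ordHom f : K) := by
  intro t ht
  obtain ⟨g, hg, hfg⟩ := hF.exists_dlog_eq p ht f.toMul
  exact ⟨g, hg, by rw [map_intCast]; exact hfg⟩

end SimplePoles

section Points

variable {K F : Type*} [Field K] [Field F] [Algebra K F] {n : ℕ} {P : Fin n → Place K F}

theorem Divisor.ofPoints_nonneg (P : Fin n → Place K F) : 0 ≤ Divisor.ofPoints P :=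
  Finset.sum_nonneg fun _ _ => Finsupp.single_nonneg.2 zero_le_one

theorem Divisor.ofPoints_apply_of_forall_ne {Q : Place K F} (hQ : ∀ i, P i ≠ Q) :
    Divisor.ofPoints P Q = 0 := by
  rw [Divisor.ofPoints, Finsupp.finsetSum_apply]
  exact Finset.sum_eq_zero fun i _ => Finsupp.single_eq_of_ne (hQ i).symm

theorem Divisor.ofPoints_apply_self (hP : Function.Injective P) (i : Fin n) :
    Divisor.ofPoints P (P i) = 1 := by
  rw [Divisor.ofPoints, Finsupp.finsetSum_apply, Finset.sum_eq_single_of_mem i (Finset.mem_univ i)]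
  · exact Finsupp.single_eq_same
  · exact fun j _ hj => Finsupp.single_eq_of_ne fun h => hj (hP h).symm

theorem Divisor.support_ofPoints [DecidableEq (Place K F)] (hP : Function.Injective P) :
    (Divisor.ofPoints P).support = Finset.univ.image P := by
  ext Q
  by_cases hQ : ∃ i, P i = Q
  · obtain ⟨i, rfl⟩ := hQ
    simp [Divisor.ofPoints_apply_self hP]
  · simp [Divisor.ofPoints_apply_of_forall_ne (not_exists.1 hQ), not_exists.1 hQ]

end Points

section Codes

variable {k K F ι : Type*} [Field k] [Field K] [Field F] [Algebra k K] [Algebra K F]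
  [Module k Ω[F⁄K]] [Fintype ι] {n : ℕ}

variable (k K) in
/-- The map sending coefficients `c` in `k` to the differential form `∑ i, c i • df i / f i`. -/
noncomputable def dlogCombination (f : ι → Additive Fˣ) : (ι → k) →ₗ[k] Ω[F⁄K] :=
  Fintype.linearCombination k fun i => dlog K F (f i)

variable (k) in
/-- The map sending coefficients `c` in `k` to the residues of `∑ i, c i • df i / f i` at the
places `P j`: the residue of a logarithmic differential is the order of the function. -/
noncomputable def residueCombination (P : Fin n → Place K F) (f : ι → Additive Fˣ) :
    (ι → k) →ₗ[k] (Fin n → k) :=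
  Fintype.linearCombination k fun i j => ((P j).ordHom (f i) : k)

variable [IsScalarTower k K Ω[F⁄K]] (p : ℕ) [Fact p.Prime] [CharP F p] [PerfectField K]
include p

theorem IsFunctionField.isCartierIter_dlogCombination (hF : IsFunctionField K F) {e : ℕ}
    (hk : Nat.card k = p ^ e) (f : ι → Additive Fˣ) (c : ι → k) :
    IsCartierIter p e (dlogCombination k K f c) (dlogCombination k K f c) := by
  have : Finite k := Nat.finite_of_card_ne_zero
    (hk ▸ pow_ne_zero _ (Fact.out : p.Prime).ne_zero)
  have := Fintype.ofFinite k
  rw [dlogCombination, linearCombination_eq_linearCombination_algebraMap (K := K),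
    Fintype.linearCombination_apply]
  refine IsCartierIter.sum fun i _ => ?_
  have h := (hF.isCartierIter_dlog (p := p) (f i) e).smul (algebraMap k K (c i))
  rwa [← map_pow, ← hk, Nat.card_eq_fintype_card, FiniteField.pow_card] at h

theorem IsFunctionField.hasSimpleResidue_dlogCombination (hF : IsFunctionField K F)
    (P : Fin n → Place K F) (f : ι → Additive Fˣ) (c : ι → k) (j : Fin n) :
    (P j).HasSimpleResidue (dlogCombination k K f c)
      (algebraMap k K (residueCombination k P f c j)) := by
  have h := Place.HasSimpleResidue.linearCombination
    (fun i => hF.hasSimpleResidue_dlog p (P j) (f i)) (algebraMap k K ∘ c)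
  rw [← linearCombination_eq_linearCombination_algebraMap] at h
  simpa [dlogCombination, residueCombination, Fintype.linearCombination_apply] using h

theorem IsFunctionField.map_residueCombination_le_Car (hF : IsFunctionField K F) {e : ℕ}
    (hk : Nat.card k = p ^ e) (P : Fin n → Place K F) (G : Divisor K F) (f : ι → Additive Fˣ) :
    (((Omega (G - Divisor.ofPoints P)).restrictScalars k).comap (dlogCombination k K f)).map
      (residueCombination k P f) ≤ Car p hk P G := by
  rintro _ ⟨c, hc, rfl⟩
  exact ⟨_, hc, hF.isCartierIter_dlogCombination p hk f c,
    fun j => (hF.hasSimpleResidue_dlogCombination p P f c j).hasResidue⟩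

theorem IsFunctionField.comap_inf_ker_residueCombination_le (hF : IsFunctionField K F)
    {P : Fin n → Place K F} {G : Divisor K F} (hG : ∀ j, G (P j) = 0) (f : ι → Additive Fˣ) :
    ((Omega (G - Divisor.ofPoints P)).restrictScalars k).comap (dlogCombination k K f) ⊓
        LinearMap.ker (residueCombination k P f) ≤
      ((Omega G).restrictScalars k).comap (dlogCombination k K f) := by
  rintro c ⟨hc, hres⟩ Q
  by_cases hQ : ∃ j, P j = Q
  · obtain ⟨j, rfl⟩ := hQ
    have h := hF.hasSimpleResidue_dlogCombination p P f c j
    rw [LinearMap.mem_ker.1 hres, Pi.zero_apply, map_zero] at h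
    exact hG j ▸ h.ordGE_zero
  · have h := hc Q
    rwa [Finsupp.sub_apply, Divisor.ofPoints_apply_of_forall_ne (not_exists.1 hQ), sub_zero] at h

end Codes

section Count

open Module

variable {k K F ι : Type*} [Field k] [Field K] [Field F] [Algebra k K] [Algebra K F] [Finite K]
  {n : ℕ} (p : ℕ) [Fact p.Prime] [CharP F p]
include p

section

variable [Module k Ω[F⁄K]] [IsScalarTower k K Ω[F⁄K]] [Fintype ι] {f : ι → Additive Fˣ}

theorem IsFunctionField.range_dlogCombination_le (hF : IsFunctionField K F) {N : Divisor K F}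
    (hN : 0 ≤ N) (hfN : ∀ i, f i ∈ unitsOutside (N.support : Set (Place K F))) :
    LinearMap.range (dlogCombination k K f) ≤ (Omega (-N)).restrictScalars k := by
  rw [dlogCombination, Fintype.range_linearCombination, Submodule.span_le]
  rintro _ ⟨i, rfl⟩ Q
  have h := hF.hasSimpleResidue_dlog p Q (f i)
  by_cases hQ : Q ∈ N.support
  · have hNQ : 0 < N Q := (hN Q).lt_of_ne' (Finsupp.mem_support_iff.1 hQ)
    exact h.ordGE_neg_one.mono (neg_le_neg hNQ)
  · rw [mem_unitsOutside.1 (hfN i) Q hQ, Int.cast_zero] at h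
    exact h.ordGE_zero.mono (neg_nonpos.2 (hN Q))

theorem IsFunctionField.card_le_finrank_comap_add (hF : IsFunctionField K F) {N C : Divisor K F}
    (hN : 0 ≤ N) (hC : 0 ≤ C) (hfN : ∀ i, f i ∈ unitsOutside (N.support : Set (Place K F))) :
    (Fintype.card ι : ℤ) ≤
      finrank k (((Omega (C - N)).restrictScalars k).comap (dlogCombination k K f)) +
        finrank k K * C.deg := by
  have := hF.finite_Omega p (-N)
  have hle : Omega (C - N) ≤ Omega (-N) := Omega_antitone (neg_le_sub_iff_le_add.2
    (le_add_of_nonneg_left hC))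
  have hrange := hF.range_dlogCombination_le (k := k) p hN hfN
  have h := finrank_add_mul_le_finrank_comap_add_mul (dlogCombination k K f) hrange hle
  have hdeg := mul_le_mul_of_nonneg_left (hF.h1_le_h1_add_deg p hC (-N))
    (Nat.cast_nonneg (α := ℤ) (finrank k K))
  rw [finrank_fintype_fun_eq_card] at h
  rw [neg_add_eq_sub, mul_add, h1, h1] at hdeg
  zify at h
  linarith

theorem IsFunctionField.finrank_comap_le_finrank_Car_add (hF : IsFunctionField K F) {e : ℕ}
    (hk : Nat.card k = p ^ e) {P : Fin n → Place K F} {G : Divisor K F} (hG : ∀ j, G (P j) = 0)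
    (hf : LinearIndependent K fun i => dlog K F (f i)) :
    finrank k (((Omega (G - Divisor.ofPoints P)).restrictScalars k).comap
      (dlogCombination k K f)) ≤ finrank k (Car p hk P G) + h1 G := by
  have := hF.finite_Omega p G
  refine (finrank_le_finrank_map_add_finrank_inf_ker (residueCombination k P f) _).trans ?_
  gcongr
  · exact Submodule.finrank_mono (hF.map_residueCombination_le_Car p hk P G f)
  · exact (Submodule.finrank_mono (hF.comap_inf_ker_residueCombination_le p hG f)).trans
      (finrank_comap_linearCombination_le hf _)

end

theorem IsFunctionField.card_support_le_finrank_Car_add (hF : IsFunctionField K F) {e : ℕ}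
    (hk : Nat.card k = p ^ e) {P : Fin n → Place K F} {G N C : Divisor K F} (hN : 0 ≤ N)
    (hC : 0 ≤ C) (hG : ∀ j, G (P j) = 0) (hGN : G - Divisor.ofPoints P = C - N) :
    (N.support.card : ℤ) ≤ finrank k (Car p hk P G) + h1 G + finrank k K * C.deg + 1 := by
  classical
  let : Module k Ω[F⁄K] := .compHom _ (algebraMap k K)
  have : IsScalarTower k K Ω[F⁄K] := .of_algebraMap_smul fun _ _ => rfl
  rcases N.support.eq_empty_or_nonempty with hempty | ⟨Q, hQ⟩
  · have := Divisor.deg_nonneg hC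
    rw [hempty, Finset.card_empty]
    positivity
  obtain ⟨f, hf⟩ := hF.exists_linearIndependent_dlog p Q (N.support.erase Q)
    (Finset.notMem_erase Q _)
  have hE : insert Q (N.support.erase Q : Set (Place K F)) = N.support := by
    rw [← Finset.coe_insert, Finset.insert_erase hQ]
  have hle := hF.card_le_finrank_comap_add (k := k) p hN hC (f := fun i => f i)
    fun i => hE ▸ (f i).2
  rw [← hGN, Fintype.card_coe, Finset.cast_card_erase_of_mem hQ] at hle
  have := hF.finrank_comap_le_finrank_Car_add p hk hG hf
  omega

end Count

end CartierCode

theorem mainTheorem4_general {p e : ℕ} [Fact p.Prime]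
    {k K F : Type*} [Field k] [Field K] [Field F] [Algebra k K] [Algebra K F] [CharP F p]
    [Finite K] (hk : Nat.card k = p ^ e) (hF : CartierCode.IsFunctionField K F)
    {n : ℕ} (P : Fin n → CartierCode.Place K F) (hP : Function.Injective P)
    (Gplus Gminus : CartierCode.Divisor K F) (hplus : 0 ≤ Gplus) (hminus : 0 ≤ Gminus)
    (hplusD : Disjoint Gplus.support (CartierCode.Divisor.ofPoints P).support)
    (hminusD : Disjoint Gminus.support (CartierCode.Divisor.ofPoints P).support) :
    (Module.finrank k (CartierCode.Car p hk P (Gplus - Gminus)) : ℤ) ≥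
      (n : ℤ) - 1 + (Gminus.support.card : ℤ)
        - (Module.finrank k K : ℤ) * CartierCode.Divisor.deg Gplus
        - (CartierCode.h1 (Gplus - Gminus) : ℤ) := by
  classical
  have hG (j) : (Gplus - Gminus) (P j) = 0 := by
    have hj : P j ∈ (CartierCode.Divisor.ofPoints P).support := by
      simp [CartierCode.Divisor.support_ofPoints hP]
    rw [Finsupp.sub_apply, Finsupp.notMem_support_iff.1 (Finset.disjoint_right.1 hplusD hj),
      Finsupp.notMem_support_iff.1 (Finset.disjoint_right.1 hminusD hj), sub_zero]
  have hcard : (Gminus + CartierCode.Divisor.ofPoints P).support.card =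
      Gminus.support.card + n := by
    rw [Finsupp.support_add_eq hminusD, Finset.card_union_of_disjoint hminusD,
      CartierCode.Divisor.support_ofPoints hP, Finset.card_image_of_injective _ hP, Finset.card_fin]
  have hN : 0 ≤ Gminus + CartierCode.Divisor.ofPoints P :=
    add_nonneg hminus (CartierCode.Divisor.ofPoints_nonneg P)
  have h := hF.card_support_le_finrank_Car_add p hk hN hplus hG (sub_sub _ _ _)
  omega

theorem mainTheorem4 {p e q ℓ : ℕ} [Fact p.Prime]
    {Fq K F : Type*} [Field Fq] [Field K] [Field F] [Algebra Fq K] [Algebra K F] [CharP F p]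
    (hq : q = p ^ e) (hFq : Nat.card Fq = p ^ e) (hK : Nat.card K = q ^ ℓ)
    (hF : CartierCode.IsFunctionField K F)
    {n : ℕ} (P : Fin n → CartierCode.Place K F) (hP : Function.Injective P)
    (hrat : ∀ i, (P i).degree = 1)
    (D : CartierCode.Divisor K F) (hD : D = CartierCode.Divisor.ofPoints P)
    (G Gplus Gminus : CartierCode.Divisor K F)
    (hG : G = Gplus - Gminus) (hplus : 0 ≤ Gplus) (hminus : 0 ≤ Gminus)
    (hred : CartierCode.Divisor.IsReduced Gminus)
    (hdisj : Disjoint Gplus.support Gminus.support)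
    (hplusD : Disjoint Gplus.support D.support)
    (hminusD : Disjoint Gminus.support D.support) :
    (Module.finrank Fq (CartierCode.Car p hFq P G) : ℤ) ≥
      (n : ℤ) - 1 + (Gminus.support.card : ℤ) - (ℓ : ℤ) * CartierCode.Divisor.deg Gplus
        - (CartierCode.h1 G : ℤ) := by
  subst hD hG
  have hq0 : q ≠ 0 := hq ▸ pow_ne_zero e (Fact.out : p.Prime).ne_zero
  have : Finite K := Nat.finite_of_card_ne_zero (hK ▸ pow_ne_zero ℓ hq0)
  obtain rfl : Module.finrank Fq K = ℓ :=
    CartierCode.finrank_eq_of_card_eq_pow (by rw [hK, hq, hFq])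
  exact mainTheorem4_general hFq hF P hP Gplus Gminus hplus hminus hplusD hminusD
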